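/- Proposition (contribution of global and of local assignments in the latent block model). Setting. Let $\varphi(x,\alpha)=b(x)\exp(\alpha x-\psi(\alpha))$ be a one-dimensional exponential family in canonical form, i.e. the density with respect to a measure $\nu$ on $\mathbb R$, with $b\ge 0$ measurable, and let $\mathcal A$ be the set of $\alpha$ for which it is a well-defined probability density. Fix $g,m$. A parameter is $\theta=(\pi,\rho,\alpha)$ with $\pi$ and $\rho$ probability vectors of length $g$ and $m$ and $\alpha=(\alpha_{k\ell})$ a $g\times m$ matrix. Under $\mathbb P_\theta$, the row labels $z_i\in\{1,\dots,g\}$ $(i\le n)$ and column labels $w_j\in\{1,\dots,m\}$ $(j\le d)$ are independent with laws $\pi$ and $\rho$, and given the labels the $x_{ij}$ are independent with densities $\varphi(\cdot,\alpha_{z_iw_j})$. Write $$p(z,w,x;\theta)=\prod_i\pi_{z_i}\prod_j\rho_{w_j}\prod_{i,j}\varphi(x_{ij},\alpha_{z_iw_j}).$$ Let $\Theta$ be a set of parameters, and assume: ($H_1$) there are $c>0$ and a compact $C_\alpha\subset\mathring{\mathcal A}$ with $\Theta\subset[c,1-c]^g\times[c,1-c]^m\times C_\alpha^{g\times m}$;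 ($H_2$) the true parameter $\theta^\star$ lies in the relative interior of $\Theta$; ($H_3$) distinct $\alpha\in\mathcal A$ give distinct distributions $\varphi(\cdot,\alpha)$; ($H_4$) the rows of $\alpha^\star$ are pairwise distinct, and so are its columns. Let $((z^\star,w^\star),x)$ be drawn from $\mathbb P_{\theta^\star}$. Two assignments are equivalent, $(z,w)\sim(z',w')$, if they are equal up to a permutation of the row labels and a permutation of the column labels. Identify $z$ with its $n\times g$ indicator matrix $(\mathbf 1\{z_i=k\})_{i,k}$, let $\|\cdot\|_0$ be the number of nonzero entries of a matrix, $\|z-z^\star\|_{0,\sim}=\min_{z'\sim z}\|z'-z^\star\|_0$ (similarly for $w$), and $$S(z^\star,w^\star,r)=\{(z,w):\ \|z-z^\star\|_{0,\sim}\le rn,\ \|w-w^\star\|_{0,\sim}\le rd\}.$$ Let $\Omega_1$ be the event that each row group of $z^\star$ has at least $cn/2$ members and each column group of $w^\star$ has at least $cd/2$ members. Claim. There is a constant $C>0$, not depending on $n,d$, such that whenever $n,d\to\infty$ with $\log(d)/n\to0$ and $\log(n)/d\to0$: (i) for all $t_{nd}>0$ tending to $0$ with $t_{nd}\gg\max\bigl(\tfrac{n+d}{nd},\tfrac{\log(nd)}{\sqrt{nd}}\bigr)$,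 $$\sup_{\theta\in\Theta}\ \sum_{(z,w)\notin S(z^\star,w^\star,t_{nd})}p(z,w,x;\theta)=o_P\bigl(p(z^\star,w^\star,x;\theta^\star)\bigr);$$ (ii) $$\sup_{\theta\in\Theta}\ \sum_{\substack{(z,w)\in S(z^\star,w^\star,C)\\(z,w)\nsim(z^\star,w^\star)}}p(z,w,x;\theta)=o_P\bigl(p(z^\star,w^\star,x;\theta^\star)\bigr).$$ Both $o_P$ hold under $\mathbb P_{\theta^\star}$ and also conditionally on $\Omega_1$, that is, under $\mathbb P_{\theta^\star}(\,\cdot\mid\Omega_1)$. -/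

import Mathlib

open Set Filter Topology MeasureTheory ProbabilityTheory
open scoped ENNReal NNReal

noncomputable section

namespace LBM

/-! ### One-dimensional exponential family in canonical form -/

/-- Log-normaliser `ψ(α) = log ∫ b(x) exp(α x) dν(x)` of the family with dominating measure `ν`
(Lebesgue, counting, ...) and carrier `b`. -/
def psi (ν : Measure ℝ) (b : ℝ → ℝ) (α : ℝ) : ℝ :=
  Real.log (∫ x, b x * Real.exp (α * x) ∂ν)

/-- The density `φ(x, α) = b(x) exp(α x - ψ(α))` with respect to `ν`. -/
def phi (ν : Measure ℝ) (b : ℝ → ℝ) (x α : ℝ) : ℝ :=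
  b x * Real.exp (α * x - psi ν b α)

/-- The space `𝒜` of all `α` for which `φ(·, α)` is a well defined probability density. -/
def natParam (ν : Measure ℝ) (b : ℝ → ℝ) : Set ℝ :=
  {α | Integrable (fun x => b x * Real.exp (α * x)) ν ∧ 0 < ∫ x, b x * Real.exp (α * x) ∂ν}

/-- The probability distribution on `ℝ` with density `φ(·, α)`. -/
def obsLaw (ν : Measure ℝ) (b : ℝ → ℝ) (α : ℝ) : Measure ℝ :=
  ν.withDensity (fun x => ENNReal.ofReal (phi ν b x α))

/-! ### Parameters, assignments and data -/

/-- Parameters `θ = (π, ρ, α)`. -/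
abbrev Param (g m : ℕ) : Type := (Fin g → ℝ) × (Fin m → ℝ) × (Fin g → Fin m → ℝ)

/-- Assignments `(z, w)` of `n` rows to `g` row-groups and of `d` columns to `m` column-groups. -/
abbrev Assign (g m n d : ℕ) : Type := (Fin n → Fin g) × (Fin d → Fin m)

/-- Outcomes `((z⋆, w⋆), x)`: true assignments and `n × d` data matrix. -/
abbrev Outcome (g m n d : ℕ) : Type := Assign g m n d × (Fin n → Fin d → ℝ)

/-- `p(z, w; θ) = ∏ i, π_{z i} * ∏ j, ρ_{w j}`. -/
def labelProb {g m n d : ℕ} (θ : Param g m) (a : Assign g m n d) : ℝ :=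
  (∏ i, θ.1 (a.1 i)) * ∏ j, θ.2.1 (a.2 j)

/-- Complete likelihood
`p(z, w, x; θ) = ∏ i, π_{z i} * ∏ j, ρ_{w j} * ∏ i j, φ(x_{ij}, α_{z i, w j})`. -/
def completeLik (ν : Measure ℝ) (b : ℝ → ℝ) {g m n d : ℕ} (θ : Param g m)
    (a : Assign g m n d) (x : Fin n → Fin d → ℝ) : ℝ :=
  labelProb θ a * ∏ i, ∏ j, phi ν b (x i j) (θ.2.2 (a.1 i) (a.2 j))

/-- The law of `((z⋆, w⋆), x)` in the latent block model with parameter `θ`: the labels have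
probability `p(z, w; θ)` and, given the labels, the entries `x_{ij}` are independent with
distribution `φ(·, α_{z i, w j})`. -/
def law (ν : Measure ℝ) (b : ℝ → ℝ) {g m : ℕ} (n d : ℕ) (θ : Param g m) :
    Measure (Outcome g m n d) :=
  ∑ a : Assign g m n d, ENNReal.ofReal (labelProb θ a) •
    (Measure.dirac a).prod
      (Measure.pi fun i => Measure.pi fun j => obsLaw ν b (θ.2.2 (a.1 i) (a.2 j)))

/-! ### Label switching, distances and regular assignments -/

/-- The matrix `(z_{ik})` of indicator variables of an assignment. -/
def oneHot {n g : ℕ} (z : Fin n → Fin g) : Matrix (Fin n) (Fin g) ℝ :=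
  fun i k => if z i = k then 1 else 0

/-- `z' = z^s` for some permutation `s` of the labels, where `(z^s)_{ik} = z_{i s(k)}`. -/
def LabelEquiv {n g : ℕ} (z z' : Fin n → Fin g) : Prop :=
  ∃ s : Equiv.Perm (Fin g), ∀ i k, oneHot z' i k = oneHot z i (s k)

/-- Equivalence of pairs of assignments. -/
def AssignEquiv {g m n d : ℕ} (a a' : Assign g m n d) : Prop :=
  LabelEquiv a.1 a'.1 ∧ LabelEquiv a.2 a'.2

/-- Hamming norm of a matrix: the number of its nonzero entries. -/
def norm0 {n g : ℕ} (A : Matrix (Fin n) (Fin g) ℝ) : ℕ :=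
  (Finset.univ.filter fun e : Fin n × Fin g => A e.1 e.2 ≠ 0).card

/-- `‖z - z⋆‖_{0,∼}`, the infimum of `‖z' - z⋆‖₀` over the `z'` equivalent to `z`. -/
def dist0 {n g : ℕ} (z zs : Fin n → Fin g) : ℕ :=
  sInf {r | ∃ z', LabelEquiv z z' ∧ r = norm0 (oneHot z' - oneHot zs)}

/-- The set `S(z⋆, w⋆, r)` of local assignments. -/
def ball {g m n d : ℕ} (as : Assign g m n d) (r : ℝ) : Set (Assign g m n d) :=
  {a | (dist0 a.1 as.1 : ℝ) ≤ r * n ∧ (dist0 a.2 as.2 : ℝ) ≤ r * d}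

/-- `c`-regular assignments: every row-group has at least `c n` members and every column-group at
least `c d` members. -/
def IsRegular {g m n d : ℕ} (c : ℝ) (a : Assign g m n d) : Prop :=
  (∀ k, c * n ≤ ∑ i, oneHot a.1 i k) ∧ ∀ l, c * d ≤ ∑ j, oneHot a.2 j l

/-- The event `Ω₁` that the true assignments are `c/2`-regular. -/
def regularEvent (g m n d : ℕ) (c : ℝ) : Set (Outcome g m n d) :=
  {ω | IsRegular (c / 2) ω.1}

/-! ### The two sums and the stochastic order symbol -/

open Classical in
/-- Sum of `p(z, w, x; θ)` over the assignments outside `S(z⋆, w⋆, r)`. -/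
def globalSum (ν : Measure ℝ) (b : ℝ → ℝ) {g m n d : ℕ} (r : ℝ) (θ : Param g m)
    (ω : Outcome g m n d) : ℝ :=
  ∑ a ∈ Finset.univ.filter (fun a => a ∉ ball ω.1 r), completeLik ν b θ a ω.2

open Classical in
/-- Sum of `p(z, w, x; θ)` over the assignments in `S(z⋆, w⋆, r)` not equivalent to
`(z⋆, w⋆)`. -/
def localSum (ν : Measure ℝ) (b : ℝ → ℝ) {g m n d : ℕ} (r : ℝ) (θ : Param g m)
    (ω : Outcome g m n d) : ℝ :=
  ∑ a ∈ Finset.univ.filter (fun a => a ∈ ball ω.1 r ∧ ¬ AssignEquiv a ω.1),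
    completeLik ν b θ a ω.2

/-- `sup_{θ ∈ Θ} Y_N(θ) = o_P(R_N)` under the measures `μ_N`: for every `ε > 0`, the probability
that the supremum exceeds `ε R_N` tends to zero. The supremum is taken in `[0, ∞]`. -/
def SupIsLittleOP {E : Type*} {S : ℕ → Type*} [∀ N, MeasurableSpace (S N)]
    (μ : ∀ N, Measure (S N)) (Θ : Set E) (Y : ∀ N, E → S N → ℝ) (R : ∀ N, S N → ℝ) : Prop :=
  ∀ ε : ℝ, 0 < ε → Tendsto
    (fun N => μ N {ω | ENNReal.ofReal (ε * R N ω) < ⨆ θ ∈ Θ, ENNReal.ofReal (Y N θ ω)})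
    atTop (𝓝 0)

end LBM

end

namespace LBM

/-! ### The exponential family -/

/-! An assignment equivalent to the truth lies in every ball of nonnegative radius, so the global
and the local sum both run over assignments inequivalent to the true one. It therefore suffices that
the total over all inequivalent assignments is negligible (`supIsLittleOP_inequivalentSum`); the
distinction between global and local then plays no role.

Write the ratio of the complete likelihood at `(a, θ)` to the true one as the square of `sqrtRatio`.
Since a sum of squares of nonnegative numbers is at most the square of their sum, Markov's
inequality can be applied to the sum of the square roots. Their means are explicit: a factor from
the label weights times a product of Hellinger affinities, that is `exp (-gapSum)`
(`lintegral_sqrtRatio`). No concentration inequality for the observations is needed.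

The combinatorial input is `exists_relabelling_cost`. For regular true labels and every `θ` in `Θ`,
`gapSum` is, after a relabelling, at least a constant times `d` per misclassified row plus `n` per
misclassified column. If one assigned group collects many members of two true groups, some entries
of the true matrix separate the two, and no single parameter is close to both entries
(`exists_gap_separation`).

With such a cost the affinities are dominated by geometric weights that factorise over rows and
columns. Their total (`sum_affinity_le`) is a constant times `exp y - 1`, where `y` has order `n exp
(-B d) + d exp (-B n)`. Under the growth conditions this beats every power of `n d`
(`tendsto_pow_mul_exp_sub_one`). A union bound over a net of polynomial size in `Θ` is thus
affordable (`exists_finite_net`), and off the net the likelihood changes by a bounded factor unless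
the data are atypically large (`completeLik_le_exp_mul`, `dataLaw_large_le`). `law_exceedance_le`
assembles these estimates. Conditioning on the regular event costs at most a factor two in the
limit, because its probability tends to one. -/

/-- The measure with density `b` with respect to `ν`. -/
noncomputable def baseMeasure (ν : Measure ℝ) (b : ℝ → ℝ) : Measure ℝ :=
  ν.withDensity fun x => ENNReal.ofReal (b x)

/-- Half the Jensen gap of the log-normaliser: minus the logarithm of the Hellinger affinity of
`φ(·, s)` and `φ(·, t)`. -/
noncomputable def gap (ν : Measure ℝ) (b : ℝ → ℝ) (s t : ℝ) : ℝ :=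
  (psi ν b s + psi ν b t) / 2 - psi ν b ((s + t) / 2)

section Family

variable {ν : Measure ℝ} {b : ℝ → ℝ}

lemma integrable_exp_baseMeasure_iff (hb : Measurable b) (hb0 : ∀ x, 0 ≤ b x) (t : ℝ) :
    Integrable (fun x => Real.exp (t * x)) (baseMeasure ν b) ↔
      Integrable (fun x => b x * Real.exp (t * x)) ν := by
  rw [baseMeasure, integrable_withDensity_iff_integrable_smul' (by fun_prop) (by simp)]
  simp [ENNReal.toReal_ofReal, hb0]

lemma integral_exp_baseMeasure (hb : Measurable b) (hb0 : ∀ x, 0 ≤ b x) (t : ℝ) :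
    ∫ x, Real.exp (t * x) ∂(baseMeasure ν b) = ∫ x, b x * Real.exp (t * x) ∂ν := by
  rw [baseMeasure, integral_withDensity_eq_integral_toReal_smul (by fun_prop) (by simp)]
  simp [ENNReal.toReal_ofReal, hb0]

lemma psi_eq_cgf (hb : Measurable b) (hb0 : ∀ x, 0 ≤ b x) :
    psi ν b = cgf id (baseMeasure ν b) := by
  ext t
  simp [psi, cgf, mgf, integral_exp_baseMeasure hb hb0]

/-- For a nonzero base measure the positivity clause follows from integrability. Nonemptiness
excludes the zero measure, for which every exponential is integrable but no density exists. The
identification makes the convexity and analyticity results for cumulant generating functions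
available. -/
lemma natParam_eq_integrableExpSet (hb : Measurable b) (hb0 : ∀ x, 0 ≤ b x)
    (hne : (natParam ν b).Nonempty) :
    natParam ν b = integrableExpSet id (baseMeasure ν b) := by
  obtain ⟨s, -, hs⟩ := hne
  have h0 : baseMeasure ν b ≠ 0 := by
    intro h
    rw [← integral_exp_baseMeasure hb hb0, h] at hs
    simp at hs
  ext t
  simp only [natParam, mem_ofPred_eq, integrableExpSet, id]
  rw [← integrable_exp_baseMeasure_iff hb hb0, ← integral_exp_baseMeasure hb hb0]
  exact ⟨fun h => h.1, fun h => ⟨h, by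
    have : NeZero (baseMeasure ν b) := ⟨h0⟩
    exact integral_exp_pos h⟩⟩

lemma convex_natParam (hb : Measurable b) (hb0 : ∀ x, 0 ≤ b x) : Convex ℝ (natParam ν b) := by
  rcases (natParam ν b).eq_empty_or_nonempty with h | h
  · rw [h]; exact convex_empty
  · rw [natParam_eq_integrableExpSet hb hb0 h]; exact convex_integrableExpSet

lemma midpoint_mem_natParam (hb : Measurable b) (hb0 : ∀ x, 0 ≤ b x) {s t : ℝ}
    (hs : s ∈ natParam ν b) (ht : t ∈ natParam ν b) : (s + t) / 2 ∈ natParam ν b := by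
  have := (convex_natParam hb hb0) hs ht (a := 1 / 2) (b := 1 / 2) (by norm_num) (by norm_num)
    (by norm_num)
  convert this using 1
  simp only [smul_eq_mul]; ring

lemma midpoint_mem_interior_natParam (hb : Measurable b) (hb0 : ∀ x, 0 ≤ b x) {s t : ℝ}
    (hs : s ∈ interior (natParam ν b)) (ht : t ∈ interior (natParam ν b)) :
    (s + t) / 2 ∈ interior (natParam ν b) := by
  have := (convex_natParam hb hb0).interior hs ht (a := 1 / 2) (b := 1 / 2) (by norm_num)
    (by norm_num) (by norm_num)
  convert this using 1
  simp only [smul_eq_mul]; ring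

lemma analyticOnNhd_psi (hb : Measurable b) (hb0 : ∀ x, 0 ≤ b x) :
    AnalyticOnNhd ℝ (psi ν b) (interior (natParam ν b)) := by
  rcases (natParam ν b).eq_empty_or_nonempty with h | h
  · simp [h]
  · rw [natParam_eq_integrableExpSet hb hb0 h, psi_eq_cgf hb hb0]; exact analyticOnNhd_cgf

/-- Analyticity gives local Lipschitz bounds, and compactness turns them into a global one although
`K` need not be convex. The constant controls the variation of the likelihood between net points. -/
lemma exists_lipschitzOnWith_psi (hb : Measurable b) (hb0 : ∀ x, 0 ≤ b x) {K : Set ℝ}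
    (hK : IsCompact K) (hKA : K ⊆ interior (natParam ν b)) :
    ∃ L : ℝ≥0, LipschitzOnWith L (psi ν b) K := by
  refine LocallyLipschitzOn.exists_lipschitzOnWith_of_compact hK fun x hx => ?_
  obtain ⟨L, s, hs, hL⟩ :=
    (analyticOnNhd_psi hb hb0 x (hKA hx)).contDiffAt (n := 1) |>.exists_lipschitzOnWith
  exact ⟨L, s, mem_nhdsWithin_of_mem_nhds hs, hL⟩

lemma integral_exp_eq_exp_psi (hb : Measurable b) (hb0 : ∀ x, 0 ≤ b x) {t : ℝ}
    (ht : t ∈ natParam ν b) :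
    ∫ x, Real.exp (t * x) ∂(baseMeasure ν b) = Real.exp (psi ν b t) := by
  rw [integral_exp_baseMeasure hb hb0, psi, Real.exp_log ht.2]

lemma integrable_exp_sub_psi (hb : Measurable b) (hb0 : ∀ x, 0 ≤ b x) {t : ℝ}
    (ht : t ∈ natParam ν b) (r : ℝ) :
    Integrable (fun x => Real.exp (t * x - r)) (baseMeasure ν b) := by
  simp only [Real.exp_sub]
  exact ((integrable_exp_baseMeasure_iff hb hb0 t).2 ht.1).div_const _

lemma integral_exp_sub (hb : Measurable b) (hb0 : ∀ x, 0 ≤ b x) {t : ℝ}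
    (ht : t ∈ natParam ν b) (r : ℝ) :
    ∫ x, Real.exp (t * x - r) ∂(baseMeasure ν b) = Real.exp (psi ν b t - r) := by
  simp only [Real.exp_sub, integral_div, integral_exp_eq_exp_psi hb hb0 ht]

lemma obsLaw_eq_withDensity (hb : Measurable b) (hb0 : ∀ x, 0 ≤ b x) (t : ℝ) :
    obsLaw ν b t =
      (baseMeasure ν b).withDensity fun x => ENNReal.ofReal (Real.exp (t * x - psi ν b t)) := by
  rw [obsLaw, baseMeasure, ← withDensity_mul _ (by fun_prop) (by fun_prop)]
  congr 1
  ext x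
  simp [phi, ENNReal.ofReal_mul (hb0 x)]

lemma lintegral_obsLaw (hb : Measurable b) (hb0 : ∀ x, 0 ≤ b x) (t : ℝ) {f : ℝ → ℝ}
    (hf : Measurable f) :
    ∫⁻ x, ENNReal.ofReal (f x) ∂(obsLaw ν b t) =
      ∫⁻ x, ENNReal.ofReal (Real.exp (t * x - psi ν b t) * f x) ∂(baseMeasure ν b) := by
  rw [obsLaw_eq_withDensity hb hb0, lintegral_withDensity_eq_lintegral_mul _ (by fun_prop)
    (by fun_prop)]
  simp [ENNReal.ofReal_mul (Real.exp_nonneg _)]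

lemma isProbabilityMeasure_obsLaw (hb : Measurable b) (hb0 : ∀ x, 0 ≤ b x) {t : ℝ}
    (ht : t ∈ natParam ν b) : IsProbabilityMeasure (obsLaw ν b t) := by
  constructor
  rw [obsLaw_eq_withDensity hb hb0, withDensity_apply _ MeasurableSet.univ, Measure.restrict_univ,
    ← ofReal_integral_eq_lintegral_ofReal (integrable_exp_sub_psi hb hb0 ht _)
    (ae_of_all _ fun x => Real.exp_nonneg _), integral_exp_sub hb hb0 ht]
  simp

/-- The geometric mean of two members of the family is an unnormalised member at the midpoint, so
convexity of the parameter space makes the integral finite and computable. -/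
lemma lintegral_exp_half_obsLaw (hb : Measurable b) (hb0 : ∀ x, 0 ≤ b x) {s t : ℝ}
    (hs : s ∈ natParam ν b) (ht : t ∈ natParam ν b) :
    ∫⁻ x, ENNReal.ofReal (Real.exp (((t * x - psi ν b t) - (s * x - psi ν b s)) / 2))
      ∂(obsLaw ν b s) = ENNReal.ofReal (Real.exp (-gap ν b s t)) := by
  have hm := midpoint_mem_natParam hb hb0 hs ht
  rw [lintegral_obsLaw hb hb0 _ (by fun_prop)]
  have : ∀ x, Real.exp (s * x - psi ν b s) *
      Real.exp (((t * x - psi ν b t) - (s * x - psi ν b s)) / 2) =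
      Real.exp ((s + t) / 2 * x - (psi ν b s + psi ν b t) / 2) := fun x => by
    rw [← Real.exp_add]; congr 1; ring
  simp only [this]
  rw [← ofReal_integral_eq_lintegral_ofReal (integrable_exp_sub_psi hb hb0 hm _)
    (ae_of_all _ fun x => Real.exp_nonneg _), integral_exp_sub hb hb0 hm, gap]
  congr 2; ring

lemma lintegral_abs_obsLaw_lt_top (hb : Measurable b) (hb0 : ∀ x, 0 ≤ b x) {t : ℝ}
    (ht : t ∈ interior (natParam ν b)) :
    ∫⁻ x, ENNReal.ofReal |x| ∂(obsLaw ν b t) < ⊤ := by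
  rw [lintegral_obsLaw hb hb0 _ (by fun_prop)]
  have ht' := ht
  rw [natParam_eq_integrableExpSet hb hb0 ⟨t, interior_subset ht⟩] at ht'
  have h := integrable_pow_abs_mul_exp_of_mem_interior_integrableExpSet ht' 1
  have h' : Integrable (fun x => Real.exp (t * x - psi ν b t) * |x|) (baseMeasure ν b) := by
    refine (h.div_const (Real.exp (psi ν b t))).congr (ae_of_all _ fun x => ?_)
    simp only [id, pow_one, Real.exp_sub]; ring
  rw [← ofReal_integral_eq_lintegral_ofReal h' (ae_of_all _ fun x => by positivity)]
  exact ENNReal.ofReal_lt_top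

/-- This squared Hellinger distance gives the sign of `gap`, and through its vanishing the
identifiability used in `gap_pos`. -/
lemma integral_sq_sub_exp (hb : Measurable b) (hb0 : ∀ x, 0 ≤ b x) {s t : ℝ}
    (hs : s ∈ natParam ν b) (ht : t ∈ natParam ν b) :
    Integrable (fun x => (Real.exp ((s * x - psi ν b s) / 2) -
      Real.exp ((t * x - psi ν b t) / 2)) ^ 2) (baseMeasure ν b) ∧
    ∫ x, (Real.exp ((s * x - psi ν b s) / 2) - Real.exp ((t * x - psi ν b t) / 2)) ^ 2
      ∂(baseMeasure ν b) = 2 - 2 * Real.exp (-gap ν b s t) := by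
  have hm := midpoint_mem_natParam hb hb0 hs ht
  have key : ∀ x, (Real.exp ((s * x - psi ν b s) / 2) - Real.exp ((t * x - psi ν b t) / 2)) ^ 2 =
      Real.exp (s * x - psi ν b s) + Real.exp (t * x - psi ν b t) -
      2 * Real.exp ((s + t) / 2 * x - (psi ν b s + psi ν b t) / 2) := fun x => by
    rw [sub_sq, ← Real.exp_nat_mul, ← Real.exp_nat_mul, mul_assoc, ← Real.exp_add]
    push_cast
    ring_nf
  simp only [key]
  have i1 := integrable_exp_sub_psi hb hb0 hs (psi ν b s)
  have i2 := integrable_exp_sub_psi hb hb0 ht (psi ν b t)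
  have i3 := (integrable_exp_sub_psi hb hb0 hm ((psi ν b s + psi ν b t) / 2)).const_mul 2
  have i12 : Integrable (fun x => Real.exp (s * x - psi ν b s) + Real.exp (t * x - psi ν b t))
    (baseMeasure ν b) := i1.add i2
  refine ⟨i12.sub i3, ?_⟩
  rw [integral_sub i12 i3, integral_add i1 i2, integral_const_mul,
    integral_exp_sub hb hb0 hs, integral_exp_sub hb hb0 ht, integral_exp_sub hb hb0 hm, gap]
  simp only [sub_self, Real.exp_zero, neg_sub]
  norm_num

lemma gap_nonneg (hb : Measurable b) (hb0 : ∀ x, 0 ≤ b x) {s t : ℝ}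
    (hs : s ∈ natParam ν b) (ht : t ∈ natParam ν b) : 0 ≤ gap ν b s t := by
  have h1 := (integral_sq_sub_exp hb hb0 hs ht).2
  have h2 : 0 ≤ ∫ x, (Real.exp ((s * x - psi ν b s) / 2) -
    Real.exp ((t * x - psi ν b t) / 2)) ^ 2 ∂(baseMeasure ν b) :=
    integral_nonneg fun x => sq_nonneg _
  have h3 : Real.exp (-gap ν b s t) ≤ 1 := by linarith
  simpa using h3

lemma gap_pos (hb : Measurable b) (hb0 : ∀ x, 0 ≤ b x)
    (h3 : InjOn (obsLaw ν b) (natParam ν b)) {s t : ℝ}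
    (hs : s ∈ natParam ν b) (ht : t ∈ natParam ν b) (hst : s ≠ t) : 0 < gap ν b s t := by
  refine lt_of_le_of_ne (gap_nonneg hb hb0 hs ht) fun h0 => hst (h3 hs ht ?_)
  obtain ⟨hi, he⟩ := integral_sq_sub_exp hb hb0 hs ht
  rw [← h0] at he
  simp only [neg_zero, Real.exp_zero, mul_one, sub_self] at he
  have hae := (integral_eq_zero_iff_of_nonneg (fun x => sq_nonneg _) hi).1 he
  rw [obsLaw_eq_withDensity hb hb0, obsLaw_eq_withDensity hb hb0]
  refine withDensity_congr_ae ?_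
  filter_upwards [hae] with x hx
  simp only [Pi.zero_apply, pow_eq_zero_iff, ne_eq, OfNat.ofNat_ne_zero, not_false_eq_true,
    sub_eq_zero, Real.exp_eq_exp] at hx
  congr 2
  linarith

lemma continuousOn_gap (hb : Measurable b) (hb0 : ∀ x, 0 ≤ b x) {s : ℝ}
    (hs : s ∈ interior (natParam ν b)) :
    ContinuousOn (gap ν b s) (interior (natParam ν b)) := by
  have hc := (analyticOnNhd_psi (ν := ν) hb hb0).continuousOn
  unfold gap
  refine ((continuousOn_const.add hc).div_const 2).sub (hc.comp (by fun_prop) fun t ht => ?_)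
  exact midpoint_mem_interior_natParam hb hb0 hs ht

/-- Two distinct parameters cannot both be close to a third one. -/
lemma exists_gap_separation (hb : Measurable b) (hb0 : ∀ x, 0 ≤ b x)
    (h3 : InjOn (obsLaw ν b) (natParam ν b)) {K : Set ℝ} (hK : IsCompact K)
    (hKA : K ⊆ interior (natParam ν b)) {ι : Type*} [Finite ι] (p : ι → ℝ) (hp : ∀ i, p i ∈ K) :
    ∃ δ, 0 < δ ∧ ∀ i j, p i ≠ p j → ∀ t ∈ K, δ ≤ gap ν b (p i) t + gap ν b (p j) t := by
  have hn : ∀ t ∈ K, t ∈ natParam ν b := fun t ht => interior_subset (hKA ht)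
  have key : ∀ e : ι × ι, ∃ δ, 0 < δ ∧ (p e.1 ≠ p e.2 → ∀ t ∈ K,
      δ ≤ gap ν b (p e.1) t + gap ν b (p e.2) t) := by
    rintro ⟨i, j⟩
    by_cases hij : p i = p j
    · exact ⟨1, one_pos, fun h => absurd hij h⟩
    have hcont : ContinuousOn (fun t => gap ν b (p i) t + gap ν b (p j) t) K :=
      ((continuousOn_gap hb hb0 (hKA (hp i))).mono hKA).add
        ((continuousOn_gap hb hb0 (hKA (hp j))).mono hKA)
    obtain ⟨t, ht, hmin⟩ := hK.exists_isMinOn ⟨_, hp i⟩ hcont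
    refine ⟨gap ν b (p i) t + gap ν b (p j) t, ?_, fun _ u hu => hmin hu⟩
    -- The minimiser can coincide with at most one of the two points, so at least one of the two
    -- gaps is strictly positive there.
    by_cases hit : p i = t
    · have h1 := gap_nonneg hb hb0 (hn _ (hp i)) (hn _ ht)
      have h2 := gap_pos hb hb0 h3 (hn _ (hp j)) (hn _ ht) (fun h => hij (hit.trans h.symm))
      linarith
    · have h1 := gap_pos hb hb0 h3 (hn _ (hp i)) (hn _ ht) hit
      have h2 := gap_nonneg hb hb0 (hn _ (hp j)) (hn _ ht)
      linarith
  choose δ hδ hδ' using key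
  obtain ⟨r, hr, hr'⟩ : ∃ r, 0 < r ∧ ∀ e, r ≤ δ e := by
    rcases isEmpty_or_nonempty (ι × ι) with h | h
    · exact ⟨1, one_pos, fun e => h.elim e⟩
    · obtain ⟨e, he⟩ := Finite.exists_min δ
      exact ⟨δ e, hδ e, he⟩
  exact ⟨r, hr, fun i j hij t ht => (hr' (i, j)).trans (hδ' (i, j) hij t ht)⟩

end Family

/-! ### Misclassified rows and columns -/

section Confusion

variable {n d g m : ℕ}

/-- Entry of the confusion matrix: number of items of true label `k` and assigned label `k'`. -/
def confusion (zs z : Fin n → Fin g) (k k' : Fin g) : ℕ :=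
  (Finset.univ.filter fun i => zs i = k ∧ z i = k').card

/-- Number of items at which two labellings differ. -/
def hamming (z z' : Fin n → Fin g) : ℕ := (Finset.univ.filter fun i => z i ≠ z' i).card

lemma confusion_le (zs z : Fin n → Fin g) (k k' : Fin g) : (confusion zs z k k' : ℝ) ≤ n := by
  have := Finset.card_le_univ (Finset.univ.filter fun i => zs i = k ∧ z i = k')
  rw [Fintype.card_fin] at this
  exact_mod_cast this

lemma hamming_le (z z' : Fin n → Fin g) : (hamming z z' : ℝ) ≤ n := by
  have := Finset.card_le_univ (Finset.univ.filter fun i => z i ≠ z' i)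
  rw [Fintype.card_fin] at this
  exact_mod_cast this

lemma sum_confusion (zs z : Fin n → Fin g) (k : Fin g) :
    ∑ k', confusion zs z k k' = (Finset.univ.filter fun i => zs i = k).card := by
  rw [Finset.card_eq_sum_card_fiberwise (f := z) (t := Finset.univ) (by simp)]
  simp [confusion, Finset.filter_filter]

/-- Every large group has a label that is assigned to a positive fraction of the items. -/
lemma exists_majority (zs z : Fin n → Fin g) {r : ℝ} (k : Fin g)
    (hr : r ≤ ∑ i, oneHot zs i k) : ∃ k', r / g ≤ confusion zs z k k' := by
  have hg : (0 : ℝ) < g := by exact_mod_cast k.pos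
  by_contra! h
  have h1 : ∑ k', (confusion zs z k k' : ℝ) < ∑ _k' : Fin g, r / g :=
    Finset.sum_lt_sum_of_nonempty ⟨k, Finset.mem_univ _⟩ fun k' _ => h k'
  have h2 : ∑ i, oneHot zs i k = ∑ k', (confusion zs z k k' : ℝ) := by
    rw [← Nat.cast_sum, sum_confusion]
    simp [oneHot]
  rw [← h2, Finset.sum_const, Finset.card_univ, Fintype.card_fin, nsmul_eq_mul,
    mul_div_cancel₀ _ hg.ne'] at h1
  linarith

/-- Only the rows from `k₁` or `k₂` sent to `k'` and the columns from `l` sent to `l'` are kept. One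
row of each origin, paired with such a column, costs at least `δ`; the number of such row pairs is
the smaller of the two confusion counts. -/
lemma mul_min_confusion_le (zs z : Fin n → Fin g) (ws w : Fin d → Fin m)
    {D : Fin g → Fin m → Fin g → Fin m → ℝ} (hD : ∀ k l k' l', 0 ≤ D k l k' l')
    {k₁ k₂ k' : Fin g} (hk : k₁ ≠ k₂) {l l' : Fin m} {δ : ℝ}
    (hδ : δ ≤ D k₁ l k' l' + D k₂ l k' l') :
    δ * confusion ws w l l' * min (confusion zs z k₁ k' : ℝ) (confusion zs z k₂ k') ≤
      ∑ i, ∑ j, D (zs i) (ws j) (z i) (w j) := by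
  set A₁ := Finset.univ.filter fun i => zs i = k₁ ∧ z i = k'
  set A₂ := Finset.univ.filter fun i => zs i = k₂ ∧ z i = k'
  set B := Finset.univ.filter fun j => ws j = l ∧ w j = l'
  have hdis : Disjoint A₁ A₂ := by
    rw [Finset.disjoint_left]
    intro i h1 h2
    simp only [A₁, A₂, Finset.mem_filter] at h1 h2
    exact hk (h1.2.1.symm.trans h2.2.1)
  have hblock : ∀ k, ∑ i ∈ Finset.univ.filter (fun i => zs i = k ∧ z i = k'), ∑ j ∈ B,
      D (zs i) (ws j) (z i) (w j) = confusion zs z k k' * (confusion ws w l l' * D k l k' l') := by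
    intro k
    have : ∀ i ∈ Finset.univ.filter (fun i => zs i = k ∧ z i = k'), ∑ j ∈ B,
        D (zs i) (ws j) (z i) (w j) = confusion ws w l l' * D k l k' l' := by
      intro i hi
      rw [confusion, ← nsmul_eq_mul, ← Finset.sum_const]
      refine Finset.sum_congr rfl fun j hj => ?_
      simp only [Finset.mem_filter, Finset.mem_univ, true_and] at hi hj
      rw [hi.1, hi.2, hj.1, hj.2]
    rw [Finset.sum_congr rfl this, Finset.sum_const, nsmul_eq_mul,
      confusion, confusion]
  have hlow : ∑ i ∈ A₁ ∪ A₂, ∑ j ∈ B, D (zs i) (ws j) (z i) (w j) ≤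
      ∑ i, ∑ j, D (zs i) (ws j) (z i) (w j) := by
    refine (Finset.sum_le_sum fun i _ => Finset.sum_le_univ_sum_of_nonneg fun j => hD _ _ _ _).trans
      (Finset.sum_le_univ_sum_of_nonneg fun i => Finset.sum_nonneg fun j _ => hD _ _ _ _)
  rw [Finset.sum_union hdis, hblock, hblock] at hlow
  refine le_trans ?_ hlow
  set q : ℝ := (confusion ws w l l' : ℝ)
  set a₁ : ℝ := (confusion zs z k₁ k' : ℝ)
  set a₂ : ℝ := (confusion zs z k₂ k' : ℝ)
  have hq : 0 ≤ q := Nat.cast_nonneg _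
  have ha₁ : 0 ≤ a₁ := Nat.cast_nonneg _
  have ha₂ : 0 ≤ a₂ := Nat.cast_nonneg _
  have hmin : 0 ≤ min a₁ a₂ := le_min ha₁ ha₂
  calc δ * q * min a₁ a₂ ≤ (D k₁ l k' l' + D k₂ l k' l') * q * min a₁ a₂ := by gcongr
    _ = min a₁ a₂ * (q * D k₁ l k' l') + min a₁ a₂ * (q * D k₂ l k' l') := by ring
    _ ≤ _ := add_le_add
      (mul_le_mul_of_nonneg_right (min_le_left _ _) (mul_nonneg hq (hD _ _ _ _)))
      (mul_le_mul_of_nonneg_right (min_le_right _ _) (mul_nonneg hq (hD _ _ _ _)))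

/-- Misclassified items are counted by their true group `k` and by the group `k₂` whose label `s k₂`
they received; an error means `k₂ ≠ k`. -/
lemma hamming_eq_sum_confusion (zs z : Fin n → Fin g) (s : Equiv.Perm (Fin g)) :
    hamming z (s ∘ zs) =
      ∑ k, ∑ k₂ ∈ Finset.univ.filter (fun k₂ => k₂ ≠ k), confusion zs z k (s k₂) := by
  rw [hamming, Finset.card_eq_sum_card_fiberwise (f := zs) (t := Finset.univ) (by simp)]
  refine Finset.sum_congr rfl fun k _ => ?_
  rw [Finset.card_eq_sum_card_fiberwise (f := fun i => s.symm (z i))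
    (t := Finset.univ.filter fun k₂ => k₂ ≠ k)]
  · refine Finset.sum_congr rfl fun k₂ hk₂ => ?_
    rw [confusion]
    congr 1
    ext i
    simp only [Finset.mem_filter, Finset.mem_univ, true_and, Function.comp_apply, ne_eq,
      Equiv.symm_apply_eq] at hk₂ ⊢
    constructor
    · rintro ⟨⟨-, h2⟩, h3⟩; exact ⟨h2, h3⟩
    · rintro ⟨h2, h3⟩
      refine ⟨⟨fun h => hk₂ ?_, h2⟩, h3⟩
      rw [h2, h3] at h
      exact s.injective h
  · intro i hi
    simp only [Finset.coe_filter, Finset.mem_filter, Finset.mem_univ, true_and,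
      Function.comp_apply, mem_ofPred_eq, ne_eq] at hi ⊢
    intro h
    apply hi.1
    rw [hi.2, ← h, Equiv.apply_symm_apply]

/-- Cost of misclassified rows, given that the column groups are roughly recovered. -/
lemma hamming_row_le (zs z : Fin n → Fin g) (ws w : Fin d → Fin m)
    {D : Fin g → Fin m → Fin g → Fin m → ℝ} (hD : ∀ k l k' l', 0 ≤ D k l k' l')
    {δ β γ : ℝ} (hδ0 : 0 ≤ δ) (hβ0 : 0 ≤ β) (hβ1 : β ≤ 1) (hγ : 0 ≤ γ)
    (hδ : ∀ k₁ k₂, k₁ ≠ k₂ → ∃ l, ∀ k' l', δ ≤ D k₁ l k' l' + D k₂ l k' l')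
    {s : Fin g → Fin g} {u : Fin m → Fin m} (hs : ∀ k, β * n ≤ confusion zs z k (s k))
    (hu : ∀ l, γ * d ≤ confusion ws w l (u l)) :
    (δ * γ * β * (n * d) ≤ ∑ i, ∑ j, D (zs i) (ws j) (z i) (w j)) ∨
    ∃ σ : Equiv.Perm (Fin g), δ * γ * β * (d * hamming z (σ ∘ zs)) ≤
      (g : ℝ) ^ 2 * ∑ i, ∑ j, D (zs i) (ws j) (z i) (w j) := by
  set T₀ := ∑ i, ∑ j, D (zs i) (ws j) (z i) (w j)
  have hT : 0 ≤ T₀ := Finset.sum_nonneg fun i _ => Finset.sum_nonneg fun j _ => hD _ _ _ _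
  have key : ∀ k₁ k₂ k', k₁ ≠ k₂ →
      δ * (γ * d) * min (confusion zs z k₁ k' : ℝ) (confusion zs z k₂ k') ≤ T₀ := by
    intro k₁ k₂ k' hk
    obtain ⟨l, hl⟩ := hδ k₁ k₂ hk
    refine le_trans ?_ (mul_min_confusion_le zs z ws w hD hk (hl k' (u l)))
    gcongr
    exact hu l
  -- If the majority labels are distinct they define the relabelling. Otherwise two true groups
  -- share a majority label, and this merger alone costs order `n d`.
  by_cases hinj : Function.Injective s
  · right
    refine ⟨Equiv.ofBijective s (Finite.injective_iff_bijective.1 hinj), ?_⟩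
    set σ := Equiv.ofBijective s (Finite.injective_iff_bijective.1 hinj)
    rw [hamming_eq_sum_confusion]
    have hterm : ∀ k k₂, k₂ ≠ k → δ * γ * β * (d * (confusion zs z k (σ k₂) : ℝ)) ≤ T₀ := by
      intro k k₂ hk
      refine le_trans ?_ (key k k₂ (σ k₂) hk.symm)
      -- The intruders from `k` are at most `n`, while group `k₂` has at least `β n` members at its
      -- own majority label, so the minimum is at least `β` times the number of intruders.
      have h1 : β * (confusion zs z k (σ k₂) : ℝ) ≤
          min (confusion zs z k (σ k₂) : ℝ) (confusion zs z k₂ (σ k₂)) := by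
        refine le_min (mul_le_of_le_one_left (Nat.cast_nonneg _) hβ1) ?_
        exact (mul_le_mul_of_nonneg_left (confusion_le _ _ _ _) hβ0).trans (hs k₂)
      calc δ * γ * β * (d * (confusion zs z k (σ k₂) : ℝ))
          = δ * (γ * d) * (β * (confusion zs z k (σ k₂) : ℝ)) := by ring
        _ ≤ _ := by gcongr
    push_cast
    simp only [Finset.mul_sum]
    calc _ ≤ ∑ _k : Fin g, ∑ _k₂ : Fin g, T₀ := by
          refine Finset.sum_le_sum fun k _ => ?_
          refine (Finset.sum_le_sum fun k₂ hk₂ => hterm k k₂ (Finset.mem_filter.1 hk₂).2).trans ?_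
          exact Finset.sum_le_univ_sum_of_nonneg fun _ => hT
      _ = _ := by simp [sq, mul_assoc]
  · left
    simp only [Function.Injective, not_forall] at hinj
    obtain ⟨k₁, k₂, he, hk⟩ := hinj
    refine le_trans ?_ (key k₁ k₂ (s k₁) hk)
    have h1 : β * n ≤ min (confusion zs z k₁ (s k₁) : ℝ) (confusion zs z k₂ (s k₁)) :=
      le_min (hs k₁) (he ▸ hs k₂)
    calc δ * γ * β * (n * d) = δ * (γ * d) * (β * n) := by ring
      _ ≤ _ := by gcongr

/-- For regular true assignments, every assignment costs at least a multiple of the number of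
misclassified rows and columns, up to relabelling. -/
lemma exists_relabelling_cost (g m : ℕ) {c δ : ℝ} (hc : 0 < c) (hc1 : c ≤ 1) (hδ0 : 0 < δ) :
    ∃ B : ℝ, 0 < B ∧ ∀ (n d : ℕ) (as a : Assign g m n d), IsRegular c as →
      ∀ D : Fin g → Fin m → Fin g → Fin m → ℝ, (∀ k l k' l', 0 ≤ D k l k' l') →
      (∀ k₁ k₂, k₁ ≠ k₂ → ∃ l, ∀ k' l', δ ≤ D k₁ l k' l' + D k₂ l k' l') →
      (∀ l₁ l₂, l₁ ≠ l₂ → ∃ k, ∀ k' l', δ ≤ D k l₁ k' l' + D k l₂ k' l') →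
      ∃ (σ : Equiv.Perm (Fin g)) (τ : Equiv.Perm (Fin m)),
        B * (d * hamming a.1 (σ ∘ as.1) + n * hamming a.2 (τ ∘ as.2)) ≤
          ∑ i, ∑ j, D (as.1 i) (as.2 j) (a.1 i) (a.2 j) := by
  -- Dividing by `g + 1` instead of `g` keeps the constant positive and at most one even when `g =
  -- 0`.
  set β : ℝ := c / (g + 1)
  set γ : ℝ := c / (m + 1)
  have hβ0 : 0 < β := by positivity
  have hγ0 : 0 < γ := by positivity
  have hβ1 : β ≤ 1 := (div_le_self hc.le (by simp)).trans hc1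
  have hγ1 : γ ≤ 1 := (div_le_self hc.le (by simp)).trans hc1
  set E : ℝ := δ * γ * β
  have hE : 0 < E := by positivity
  -- The two squares absorb the losses of the row and column bounds, and the `2` serves the case of
  -- merged groups.
  set M : ℝ := (g : ℝ) ^ 2 + (m : ℝ) ^ 2 + 2
  have hM : 0 < M := by positivity
  refine ⟨E / M, by positivity, fun n d as a hreg D hD hrow hcol => ?_⟩
  have hs : ∀ k, ∃ k', β * n ≤ confusion as.1 a.1 k k' := by
    intro k
    obtain ⟨k', hk'⟩ := exists_majority as.1 a.1 k (hreg.1 k)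
    refine ⟨k', le_trans ?_ hk'⟩
    have : (0 : ℝ) < g := by exact_mod_cast k.pos
    rw [div_mul_eq_mul_div]
    gcongr
    linarith
  have hu : ∀ l, ∃ l', γ * d ≤ confusion as.2 a.2 l l' := by
    intro l
    obtain ⟨l', hl'⟩ := exists_majority as.2 a.2 l (hreg.2 l)
    refine ⟨l', le_trans ?_ hl'⟩
    have : (0 : ℝ) < m := by exact_mod_cast l.pos
    rw [div_mul_eq_mul_div]
    gcongr
    linarith
  choose s hs using hs
  choose u hu using hu
  have hR := hamming_row_le as.1 a.1 as.2 a.2 hD hδ0.le hβ0.le hβ1 hγ0.le hrow hs hu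
  -- Columns are handled by the row bound applied to the transposed array.
  have hC := hamming_row_le as.2 a.2 as.1 a.1 (D := fun l k l' k' => D k l k' l')
    (fun _ _ _ _ => hD _ _ _ _) hδ0.le hγ0.le hγ1 hβ0.le
    (fun l₁ l₂ h => (hcol l₁ l₂ h).imp fun k hk l' k' => hk k' l') hu hs
  rw [Finset.sum_comm] at hC
  set T₀ := ∑ i, ∑ j, D (as.1 i) (as.2 j) (a.1 i) (a.2 j)
  have hT : 0 ≤ T₀ := Finset.sum_nonneg fun i _ => Finset.sum_nonneg fun j _ => hD _ _ _ _
  have e1 : δ * β * γ = E := by simp only [E]; ring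
  rw [e1, mul_comm (d : ℝ) (n : ℝ)] at hC
  -- When the cost is already of order `n d`, any relabelling works, since the weighted error count
  -- never exceeds `2 n d`.
  have hfar : E * (n * d) ≤ T₀ → ∃ (σ : Equiv.Perm (Fin g)) (τ : Equiv.Perm (Fin m)),
        E / M * (d * hamming a.1 (σ ∘ as.1) + n * hamming a.2 (τ ∘ as.2)) ≤ T₀ := by
    intro h
    refine ⟨1, 1, ?_⟩
    rw [div_mul_eq_mul_div, div_le_iff₀ hM]
    have h1 : (d : ℝ) * hamming a.1 ((1 : Equiv.Perm (Fin g)) ∘ as.1) ≤ d * n :=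
      mul_le_mul_of_nonneg_left (hamming_le _ _) (Nat.cast_nonneg _)
    have h2 : (n : ℝ) * hamming a.2 ((1 : Equiv.Perm (Fin m)) ∘ as.2) ≤ n * d :=
      mul_le_mul_of_nonneg_left (hamming_le _ _) (Nat.cast_nonneg _)
    calc _ ≤ E * (d * n + n * d) := by gcongr
      _ = 2 * (E * (n * d)) := by ring
      _ ≤ 2 * T₀ := by linarith
      _ ≤ T₀ * M := by rw [mul_comm]; gcongr; simp only [M]; nlinarith
  rcases hR with h | ⟨σ, hσ⟩
  · exact hfar h
  rcases hC with h | ⟨τ, hτ⟩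
  · exact hfar h
  refine ⟨σ, τ, ?_⟩
  rw [div_mul_eq_mul_div, div_le_iff₀ hM, mul_add]
  calc _ ≤ (g : ℝ) ^ 2 * T₀ + (m : ℝ) ^ 2 * T₀ := add_le_add hσ hτ
    _ ≤ T₀ * M := by simp only [M]; nlinarith

end Confusion

/-! ### Sums over labellings -/

section Labels

variable {n d g m : ℕ}

lemma sum_prod_apply_eq (f : Fin n → Fin g → ℝ) :
    ∑ z : Fin n → Fin g, ∏ i, f i (z i) = ∏ i, ∑ k, f i k := by
  rw [Finset.prod_univ_sum, Fintype.piFinset_univ]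

/-- The weight factorises over items, and each item contributes at most `1 + g q ≤ exp (g q)`. -/
lemma sum_pow_hamming_le (z₀ : Fin n → Fin g) {q : ℝ} (hq : 0 ≤ q) :
    ∑ z : Fin n → Fin g, q ^ hamming z z₀ ≤ Real.exp (g * n * q) := by
  have h1 : ∀ z : Fin n → Fin g, q ^ hamming z z₀ = ∏ i, if z i ≠ z₀ i then q else 1 := by
    intro z
    rw [Finset.prod_ite, Finset.prod_const, Finset.prod_const_one, mul_one, hamming]
  simp only [h1]
  rw [sum_prod_apply_eq fun i k => if k ≠ z₀ i then q else 1]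
  have h2 : ∀ i : Fin n, ∑ k, (if k ≠ z₀ i then q else 1) ≤ Real.exp (g * q) := by
    intro i
    have : ∑ k, (if k ≠ z₀ i then q else 1) ≤ ∑ k, (q + if k = z₀ i then 1 else 0) :=
      Finset.sum_le_sum fun k _ => by by_cases h : k = z₀ i <;> simp [h, hq]
    refine this.trans ?_
    rw [Finset.sum_add_distrib]
    simpa using Real.add_one_le_exp (g * q)
  calc _ ≤ ∏ _i : Fin n, Real.exp (g * q) :=
        Finset.prod_le_prod (fun i _ => Finset.sum_nonneg fun k _ => by split_ifs <;> simp [hq])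
          fun i _ => h2 i
    _ = _ := by rw [Finset.prod_const, ← Real.exp_nat_mul]; simp; ring

lemma sum_ne_pow_hamming_le (a₀ : Assign g m n d) {q₁ q₂ : ℝ} (hq₁ : 0 ≤ q₁) (hq₂ : 0 ≤ q₂) :
    ∑ a ∈ Finset.univ.filter (fun a => a ≠ a₀), q₁ ^ hamming a.1 a₀.1 * q₂ ^ hamming a.2 a₀.2 ≤
      Real.exp (g * n * q₁ + m * d * q₂) - 1 := by
  rw [Finset.filter_ne', le_sub_iff_add_le]
  have h0 : q₁ ^ hamming a₀.1 a₀.1 * q₂ ^ hamming a₀.2 a₀.2 = 1 := by simp [hamming]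
  have h := Finset.sum_erase_add Finset.univ
    (fun a : Assign g m n d => q₁ ^ hamming a.1 a₀.1 * q₂ ^ hamming a.2 a₀.2) (Finset.mem_univ a₀)
  simp only [h0] at h
  rw [h, Fintype.sum_prod_type, Real.exp_add]
  simp only [← Finset.mul_sum, ← Finset.sum_mul]
  exact mul_le_mul (sum_pow_hamming_le _ hq₁) (sum_pow_hamming_le _ hq₂)
    (Finset.sum_nonneg fun z _ => pow_nonneg hq₂ _) (Real.exp_nonneg _)

lemma sum_labelProb_relabel (θ : Param g m) (hπ : ∑ k, θ.1 k = 1) (hρ : ∑ l, θ.2.1 l = 1)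
    (σ : Equiv.Perm (Fin g)) (τ : Equiv.Perm (Fin m)) :
    ∑ a : Assign g m n d, labelProb θ (σ ∘ a.1, τ ∘ a.2) = 1 := by
  rw [Fintype.sum_prod_type]
  simp only [labelProb, Function.comp_apply, ← Finset.mul_sum, ← Finset.sum_mul]
  rw [sum_prod_apply_eq fun _ k => θ.1 (σ k), sum_prod_apply_eq fun _ l => θ.2.1 (τ l)]
  simp only [Equiv.sum_comp σ θ.1, Equiv.sum_comp τ θ.2.1, hπ, hρ]
  simp

lemma sum_labelProb (θ : Param g m) (hπ : ∑ k, θ.1 k = 1) (hρ : ∑ l, θ.2.1 l = 1) :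
    ∑ a : Assign g m n d, labelProb θ a = 1 := by
  simpa using sum_labelProb_relabel (n := n) (d := d) θ hπ hρ 1 1

/-- Mixing proportions bounded away from zero and one. -/
def InBox (c : ℝ) (θ : Param g m) : Prop :=
  (∀ k, θ.1 k ∈ Icc c 1) ∧ ∀ l, θ.2.1 l ∈ Icc c 1

lemma labelProb_pos {c : ℝ} (hc : 0 < c) {θ : Param g m} (hθ : InBox c θ) (a : Assign g m n d) :
    0 < labelProb θ a :=
  mul_pos (Finset.prod_pos fun _ _ => hc.trans_le (hθ.1 _).1)
    (Finset.prod_pos fun _ _ => hc.trans_le (hθ.2 _).1)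

lemma prod_mul_pow_hamming_le {c : ℝ} (hc : 0 < c) {p : Fin g → ℝ} (hp : ∀ k, p k ∈ Icc c 1)
    (z z' : Fin n → Fin g) : (∏ i, p (z i)) * c ^ hamming z z' ≤ ∏ i, p (z' i) := by
  have h1 : c ^ hamming z z' = ∏ i, if z i ≠ z' i then c else 1 := by
    rw [Finset.prod_ite, Finset.prod_const, Finset.prod_const_one, mul_one, hamming]
  rw [h1, ← Finset.prod_mul_distrib]
  have hp0 : ∀ k, 0 ≤ p k := fun k => hc.le.trans (hp k).1
  refine Finset.prod_le_prod (fun i _ => mul_nonneg (hp0 _) (by split_ifs <;> simp [hc.le]))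
    fun i _ => ?_
  by_cases h : z i = z' i
  · simp [h]
  · simp only [ne_eq, h, not_false_eq_true, if_true]
    exact (mul_le_of_le_one_left hc.le (hp _).2).trans (hp _).1

lemma labelProb_mul_pow_le {c : ℝ} (hc : 0 < c) {θ : Param g m} (hθ : InBox c θ)
    (a a' : Assign g m n d) :
    labelProb θ a * (c ^ hamming a.1 a'.1 * c ^ hamming a.2 a'.2) ≤ labelProb θ a' := by
  have h1 := prod_mul_pow_hamming_le hc hθ.1 a.1 a'.1
  have h2 := prod_mul_pow_hamming_le hc hθ.2 a.2 a'.2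
  unfold labelProb
  calc _ = (∏ i, θ.1 (a.1 i)) * c ^ hamming a.1 a'.1 *
        ((∏ j, θ.2.1 (a.2 j)) * c ^ hamming a.2 a'.2) := by ring
    _ ≤ _ := mul_le_mul h1 h2
      (mul_nonneg (Finset.prod_nonneg fun j _ => hc.le.trans (hθ.2 _).1) (by positivity))
      (Finset.prod_nonneg fun i _ => hc.le.trans (hθ.1 _).1)

/-- Changing one label changes the weight by a factor at most `1 / c`. This bounded price per error
is later absorbed by the exponentially small affinity. -/
lemma sqrt_labelProb_le {c : ℝ} (hc : 0 < c) {θ : Param g m} (hθ : InBox c θ)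
    (a a' : Assign g m n d) :
    √(labelProb θ a) ≤ (√c)⁻¹ ^ hamming a.1 a'.1 * (√c)⁻¹ ^ hamming a.2 a'.2 *
      √(labelProb θ a') := by
  have h := Real.sqrt_le_sqrt (labelProb_mul_pow_le hc hθ a a')
  rw [Real.sqrt_mul (labelProb_pos hc hθ a).le, Real.sqrt_mul (by positivity),
    Real.sqrt_eq_rpow (c ^ _), Real.sqrt_eq_rpow (c ^ _), ← Real.rpow_pow_comm hc.le,
    ← Real.rpow_pow_comm hc.le, ← Real.sqrt_eq_rpow] at h
  have hs : 0 < √c := Real.sqrt_pos.2 hc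
  rw [inv_pow, inv_pow, ← mul_inv, inv_mul_eq_div, le_div_iff₀ (by positivity)]
  exact h

/-- Total affinity of the true assignments with all inequivalent ones. -/
lemma sum_affinity_le {c : ℝ} (hc : 0 < c) {θs θ : Param g m} (hθs : InBox c θs) (hθ : InBox c θ)
    (hπs : ∑ k, θs.1 k = 1) (hρs : ∑ l, θs.2.1 l = 1)
    (hπ : ∑ k, θ.1 k = 1) (hρ : ∑ l, θ.2.1 l = 1) {B : ℝ}
    (cost : Assign g m n d → Assign g m n d → ℝ) (S : Finset (Assign g m n d))
    (hcost : ∀ as ∈ S, ∀ a, ∃ (σ : Equiv.Perm (Fin g)) (τ : Equiv.Perm (Fin m)),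
      B * (d * hamming a.1 (σ ∘ as.1) + n * hamming a.2 (τ ∘ as.2)) ≤ cost as a)
    (U : Assign g m n d → Finset (Assign g m n d)) (hU : ∀ as, ∀ a ∈ U as, ¬ AssignEquiv a as) :
    ∑ as ∈ S, ∑ a ∈ U as,
      √(labelProb θs as * labelProb θ a) * Real.exp (-cost as a) ≤
      (g.factorial * m.factorial : ℕ) * (Real.exp (g * n * ((√c)⁻¹ * Real.exp (-(B * d))) +
        m * d * ((√c)⁻¹ * Real.exp (-(B * n)))) - 1) := by
  -- The price of one misclassified row: a factor from the mixing proportions and one from the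
  -- affinity of its `d` entries.
  set q₁ : ℝ := (√c)⁻¹ * Real.exp (-(B * d)) with hq₁
  set q₂ : ℝ := (√c)⁻¹ * Real.exp (-(B * n)) with hq₂
  have hq₁0 : 0 ≤ q₁ := by positivity
  have hq₂0 : 0 ≤ q₂ := by positivity
  set y : ℝ := Real.exp (g * n * q₁ + m * d * q₂) - 1
  have hy : 0 ≤ y := by
    have : (0 : ℝ) ≤ g * n * q₁ + m * d * q₂ := by positivity
    simpa [y] using this
  -- the bound for a fixed relabelling
  set P := Equiv.Perm (Fin g) × Equiv.Perm (Fin m)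
  let rel : P → Assign g m n d → Assign g m n d := fun p as => (p.1 ∘ as.1, p.2 ∘ as.2)
  let wt : P → Assign g m n d → Assign g m n d → ℝ := fun p as a =>
    √(labelProb θs as) * √(labelProb θ (rel p as)) *
      (q₁ ^ hamming a.1 (rel p as).1 * q₂ ^ hamming a.2 (rel p as).2)
  have hwt : ∀ p as a, 0 ≤ wt p as a := fun p as a => by positivity
  -- Every relabelling of `as` is equivalent to `as`. Excluding these is what removes the leading
  -- `1` and leaves the small quantity `y`.
  have hne : ∀ p as, ∀ a ∈ U as, a ≠ rel p as := by
    rintro ⟨σ, τ⟩ as a ha rfl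
    refine hU as _ ha ⟨⟨σ, fun i k => ?_⟩, ⟨τ, fun i k => ?_⟩⟩ <;> simp [rel, oneHot]
  have hterm : ∀ as ∈ S, ∀ a, ∃ p : P,
      √(labelProb θs as * labelProb θ a) * Real.exp (-cost as a) ≤ wt p as a := by
    intro as has a
    obtain ⟨σ, τ, h⟩ := hcost as has a
    refine ⟨(σ, τ), ?_⟩
    have h1 := sqrt_labelProb_le hc hθ a (rel (σ, τ) as)
    rw [Real.sqrt_mul (labelProb_pos hc hθs _).le]
    have h2 : Real.exp (-cost as a) ≤ Real.exp (-(B * d)) ^ hamming a.1 (rel (σ, τ) as).1 *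
        Real.exp (-(B * n)) ^ hamming a.2 (rel (σ, τ) as).2 := by
      rw [← Real.exp_nat_mul, ← Real.exp_nat_mul, ← Real.exp_add]
      refine Real.exp_le_exp.2 ?_
      simp only [rel]
      linarith
    calc _ ≤ √(labelProb θs as) * ((√c)⁻¹ ^ hamming a.1 (rel (σ, τ) as).1 *
          (√c)⁻¹ ^ hamming a.2 (rel (σ, τ) as).2 * √(labelProb θ (rel (σ, τ) as))) *
          (Real.exp (-(B * d)) ^ hamming a.1 (rel (σ, τ) as).1 *
        Real.exp (-(B * n)) ^ hamming a.2 (rel (σ, τ) as).2) := by gcongr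
      _ = wt (σ, τ) as a := by
        simp only [wt, hq₁, hq₂, mul_pow]; ring
  -- The good relabelling depends on `as` and `a`; summing over all relabellings removes this
  -- dependence and produces the factorials.
  have hterm' : ∀ as ∈ S, ∀ a,
      √(labelProb θs as * labelProb θ a) * Real.exp (-cost as a) ≤ ∑ p : P, wt p as a := by
    intro as has a
    obtain ⟨p, hp⟩ := hterm as has a
    exact hp.trans (Finset.single_le_sum (f := fun p => wt p as a) (fun p _ => hwt p as a)
      (Finset.mem_univ p))
  have hP : ∀ p : P, ∑ as ∈ S, ∑ a ∈ U as, wt p as a ≤ y := by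
    intro p
    -- By the arithmetic-geometric mean inequality the weight is at most an average of two label
    -- probabilities, each of total mass one over all `as`.
    have h1 : ∀ as, ∑ a ∈ U as, wt p as a ≤
        (labelProb θs as + labelProb θ (rel p as)) / 2 * y := by
      intro as
      simp only [wt, ← Finset.mul_sum]
      refine mul_le_mul ?_ ?_ (Finset.sum_nonneg fun a _ => by positivity) ?_
      · have e1 := Real.sq_sqrt (labelProb_pos hc hθs as).le
        have e2 := Real.sq_sqrt (labelProb_pos hc hθ (rel p as)).le
        nlinarith [sq_nonneg (√(labelProb θs as) - √(labelProb θ (rel p as)))]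
      · refine le_trans (Finset.sum_le_sum_of_subset_of_nonneg (fun a ha => ?_)
          fun a _ _ => by positivity) (sum_ne_pow_hamming_le (rel p as) hq₁0 hq₂0)
        simp [hne p as a ha]
      · have := labelProb_pos hc hθs as
        have := labelProb_pos hc hθ (rel p as)
        positivity
    calc _ ≤ ∑ as ∈ S, (labelProb θs as + labelProb θ (rel p as)) / 2 * y :=
          Finset.sum_le_sum fun as _ => h1 as
      _ ≤ ∑ as, (labelProb θs as + labelProb θ (rel p as)) / 2 * y := by
          refine Finset.sum_le_univ_sum_of_nonneg fun as => ?_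
          have := labelProb_pos hc hθs as
          have := labelProb_pos hc hθ (rel p as)
          positivity
      _ = y := by
          rw [← Finset.sum_mul, ← Finset.sum_div, Finset.sum_add_distrib,
            sum_labelProb θs hπs hρs, sum_labelProb_relabel θ hπ hρ p.1 p.2]
          norm_num
  calc _ ≤ ∑ as ∈ S, ∑ a ∈ U as, ∑ p : P, wt p as a :=
        Finset.sum_le_sum fun as has => Finset.sum_le_sum fun a _ => hterm' as has a
    _ = ∑ p : P, ∑ as ∈ S, ∑ a ∈ U as, wt p as a := by
        symm
        rw [Finset.sum_comm]
        exact Finset.sum_congr rfl fun as _ => Finset.sum_comm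
    _ ≤ ∑ _p : P, y := Finset.sum_le_sum fun p _ => hP p
    _ = _ := by
        rw [Finset.sum_const, nsmul_eq_mul, Finset.card_univ, Fintype.card_prod,
          Fintype.card_perm, Fintype.card_perm, Fintype.card_fin, Fintype.card_fin]

/-- Chernoff bound for the size of one group. -/
lemma sum_small_group_le {c : ℝ} {p : Fin g → ℝ} (hp : ∀ k, 0 ≤ p k) (hp1 : ∑ k, p k = 1)
    (k : Fin g) (hk : c ≤ p k) :
    ∑ z ∈ Finset.univ.filter (fun z : Fin n → Fin g => ∑ i, oneHot z i k < c / 2 * n),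
      ∏ i, p (z i) ≤ Real.exp (-(c * (1 / 2 - Real.exp (-1)) * n)) := by
  have hind : ∀ z : Fin n → Fin g, ∏ i, (p (z i) * Real.exp (-(if z i = k then 1 else 0))) =
      (∏ i, p (z i)) * Real.exp (-∑ i, oneHot z i k) := by
    intro z
    rw [Finset.prod_mul_distrib, ← Real.exp_sum, Finset.sum_neg_distrib]
    rfl
  have hone : ∑ k', p k' * Real.exp (-(if k' = k then 1 else 0)) ≤
      Real.exp (-(c * (1 - Real.exp (-1)))) := by
    have h1 : ∀ k', p k' * Real.exp (-(if k' = k then 1 else 0)) =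
        p k' - if k' = k then p k * (1 - Real.exp (-1)) else 0 := by
      intro k'
      by_cases h : k' = k
      · subst h; simp; ring
      · simp [h]
    simp only [h1]
    rw [Finset.sum_sub_distrib, hp1]
    simp only [Finset.sum_ite_eq', Finset.mem_univ, if_true]
    have h2 : Real.exp (-1) ≤ 1 := Real.exp_le_one_iff.2 (by norm_num)
    have h3 := Real.add_one_le_exp (-(c * (1 - Real.exp (-1))))
    have h4 : c * (1 - Real.exp (-1)) ≤ p k * (1 - Real.exp (-1)) :=
      mul_le_mul_of_nonneg_right hk (by linarith)
    linarith
  -- Exponential Markov inequality with tilt `-1`: the rate is `c (1 - 1/e) - c/2`, positive because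
  -- `e > 2`.
  calc _ ≤ ∑ z ∈ Finset.univ.filter (fun z : Fin n → Fin g => ∑ i, oneHot z i k < c / 2 * n),
        Real.exp (c / 2 * n) * ((∏ i, p (z i)) * Real.exp (-∑ i, oneHot z i k)) := by
        refine Finset.sum_le_sum fun z hz => ?_
        have hz' := (Finset.mem_filter.1 hz).2
        have hpz : 0 ≤ ∏ i, p (z i) := Finset.prod_nonneg fun i _ => hp _
        have : 1 ≤ Real.exp (c / 2 * n) * Real.exp (-∑ i, oneHot z i k) := by
          rw [← Real.exp_add]; exact Real.one_le_exp (by linarith)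
        calc _ ≤ (∏ i, p (z i)) * (Real.exp (c / 2 * n) * Real.exp (-∑ i, oneHot z i k)) :=
              le_mul_of_one_le_right hpz this
          _ = _ := by ring
    _ ≤ ∑ z : Fin n → Fin g,
        Real.exp (c / 2 * n) * ((∏ i, p (z i)) * Real.exp (-∑ i, oneHot z i k)) :=
        Finset.sum_le_univ_sum_of_nonneg fun z => mul_nonneg (Real.exp_nonneg _)
          (mul_nonneg (Finset.prod_nonneg fun i _ => hp _) (Real.exp_nonneg _))
    _ = Real.exp (c / 2 * n) *
        ∏ _i : Fin n, ∑ k', p k' * Real.exp (-(if k' = k then 1 else 0)) := by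
        rw [← Finset.mul_sum, ← sum_prod_apply_eq]
        simp only [hind]
    _ ≤ Real.exp (c / 2 * n) * ∏ _i : Fin n, Real.exp (-(c * (1 - Real.exp (-1)))) := by
        gcongr
        · exact fun _ _ =>
            Finset.sum_nonneg fun k' _ => mul_nonneg (hp _) (Real.exp_nonneg _)
    _ = _ := by
        rw [Finset.prod_const, ← Real.exp_nat_mul, ← Real.exp_add]
        simp only [Finset.card_univ, Fintype.card_fin]
        congr 1; ring

open Classical in
/-- The true assignments are regular up to an exponentially small probability. -/
lemma sum_not_isRegular_le {c : ℝ} (hc : 0 < c) {θ : Param g m} (hθ : InBox c θ)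
    (hπ : ∑ k, θ.1 k = 1) (hρ : ∑ l, θ.2.1 l = 1) :
    ∑ a ∈ Finset.univ.filter (fun a : Assign g m n d => ¬ IsRegular (c / 2) a), labelProb θ a ≤
      g * Real.exp (-(c * (1 / 2 - Real.exp (-1)) * n)) +
        m * Real.exp (-(c * (1 / 2 - Real.exp (-1)) * d)) := by
  have hpos : ∀ a : Assign g m n d, 0 ≤ labelProb θ a := fun a => (labelProb_pos hc hθ a).le
  have hp1 : ∀ k, 0 ≤ θ.1 k := fun k => hc.le.trans (hθ.1 k).1
  have hp2 : ∀ l, 0 ≤ θ.2.1 l := fun l => hc.le.trans (hθ.2 l).1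
  have hrow : ∀ k, ∑ a : Assign g m n d,
      (if ∑ i, oneHot a.1 i k < c / 2 * n then labelProb θ a else 0) ≤
      Real.exp (-(c * (1 / 2 - Real.exp (-1)) * n)) := by
    intro k
    refine le_trans (le_of_eq ?_) (sum_small_group_le hp1 hπ k (hθ.1 k).1)
    rw [Fintype.sum_prod_type, Finset.sum_filter]
    refine Finset.sum_congr rfl fun z _ => ?_
    split_ifs with h
    · simp only [labelProb, ← Finset.mul_sum]
      rw [sum_prod_apply_eq fun _ l => θ.2.1 l]
      simp [hρ]
    · simp
  have hcol : ∀ l, ∑ a : Assign g m n d,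
      (if ∑ j, oneHot a.2 j l < c / 2 * d then labelProb θ a else 0) ≤
      Real.exp (-(c * (1 / 2 - Real.exp (-1)) * d)) := by
    intro l
    refine le_trans (le_of_eq ?_) (sum_small_group_le hp2 hρ l (hθ.2 l).1)
    rw [Fintype.sum_prod_type_right, Finset.sum_filter]
    refine Finset.sum_congr rfl fun w _ => ?_
    split_ifs with h
    · simp only [labelProb, ← Finset.sum_mul]
      rw [sum_prod_apply_eq fun _ k => θ.1 k]
      simp [hπ]
    · simp
  calc _ ≤ ∑ a : Assign g m n d,
        (∑ k, (if ∑ i, oneHot a.1 i k < c / 2 * n then labelProb θ a else 0) +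
        ∑ l, (if ∑ j, oneHot a.2 j l < c / 2 * d then labelProb θ a else 0)) := by
        rw [Finset.sum_filter]
        refine Finset.sum_le_sum fun a _ => ?_
        have n1 : ∀ k, 0 ≤ (if ∑ i, oneHot a.1 i k < c / 2 * n then labelProb θ a else 0) :=
          fun k => by split_ifs <;> simp [hpos]
        have n2 : ∀ l, 0 ≤ (if ∑ j, oneHot a.2 j l < c / 2 * d then labelProb θ a else 0) :=
          fun l => by split_ifs <;> simp [hpos]
        split_ifs with h
        · exact add_nonneg (Finset.sum_nonneg fun k _ => n1 k) (Finset.sum_nonneg fun l _ => n2 l)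
        · rw [IsRegular, not_and_or] at h
          simp only [not_forall, not_le] at h
          rcases h with ⟨k, hk⟩ | ⟨l, hl⟩
          · have := Finset.single_le_sum (fun k _ => n1 k) (Finset.mem_univ k)
            simp only [hk, if_true] at this
            exact le_add_of_le_of_nonneg this (Finset.sum_nonneg fun l _ => n2 l)
          · have := Finset.single_le_sum (fun l _ => n2 l) (Finset.mem_univ l)
            simp only [hl, if_true] at this
            exact le_add_of_nonneg_of_le (Finset.sum_nonneg fun l _ => n1 l) this
    _ ≤ _ := by
        rw [Finset.sum_add_distrib, Finset.sum_comm, Finset.sum_comm (t := Finset.univ (α := Fin m))]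
        refine add_le_add ((Finset.sum_le_sum fun k _ => hrow k).trans ?_)
          ((Finset.sum_le_sum fun l _ => hcol l).trans ?_) <;> simp

end Labels

/-! ### Nets -/

/-- A set on which finitely many coordinates are bounded has a net of polynomial size. -/
lemma exists_finite_net {E ι : Type*} [Fintype ι] (Θ : Set E) (f : ι → E → ℝ) {R η : ℝ}
    (hη : 0 < η) (hf : ∀ θ ∈ Θ, ∀ i, |f i θ| ≤ R) :
    ∃ T : Finset E, (∀ θ ∈ T, θ ∈ Θ) ∧ T.card ≤ (⌊2 * R / η⌋₊ + 1) ^ Fintype.card ι ∧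
      ∀ θ ∈ Θ, ∃ θ' ∈ T, ∀ i, |f i θ - f i θ'| ≤ η := by
  classical
  set M := ⌊2 * R / η⌋₊ + 1
  -- The code names the grid cell of `θ`. One representative is chosen from `Θ` in each occupied
  -- cell, so the net points satisfy all the constraints on parameters.
  let code : Θ → ι → ℕ := fun θ i => ⌊(f i θ + R) / η⌋₊
  have hcode : ∀ θ, code θ ∈ Fintype.piFinset fun _ : ι => Finset.range M := by
    intro θ
    rw [Fintype.mem_piFinset]
    intro i
    rw [Finset.mem_range, Nat.lt_succ_iff]
    refine Nat.floor_le_floor ?_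
    have := (abs_le.1 (hf θ θ.2 i)).2
    gcongr
    linarith
  have hfin : (range code).Finite :=
    (Finset.finite_toSet _).subset (by rintro _ ⟨θ, rfl⟩; exact hcode θ)
  rcases isEmpty_or_nonempty Θ with hΘ | hΘ
  · exact ⟨∅, by simp, by simp, fun θ hθ => (hΘ.false ⟨θ, hθ⟩).elim⟩
  choose! r hr using fun (v : ι → ℕ) (hv : v ∈ range code) => hv
  refine ⟨(hfin.toFinset.image r).image Subtype.val, ?_, ?_, ?_⟩
  · intro θ hθ
    obtain ⟨θ', -, rfl⟩ := Finset.mem_image.1 hθ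
    exact θ'.2
  · refine Finset.card_image_le.trans (Finset.card_image_le.trans ?_)
    have h : hfin.toFinset ⊆ Fintype.piFinset fun _ : ι => Finset.range M := by
      intro v hv
      obtain ⟨θ, rfl⟩ := (hfin.mem_toFinset).1 hv
      exact hcode θ
    refine (Finset.card_le_card h).trans ?_
    simp [Fintype.card_piFinset]
  · intro θ hθ
    have hmem : code ⟨θ, hθ⟩ ∈ range code := ⟨_, rfl⟩
    refine ⟨r (code ⟨θ, hθ⟩), Finset.mem_image.2 ⟨_, Finset.mem_image.2
      ⟨_, hfin.mem_toFinset.2 hmem, rfl⟩, rfl⟩, fun i => ?_⟩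
    have h := congrFun (hr _ hmem) i
    have e1 : code (r (code ⟨θ, hθ⟩)) i = code ⟨θ, hθ⟩ i := h
    simp only [code] at e1
    set θ' := r (code ⟨θ, hθ⟩)
    have p1 : 0 ≤ (f i θ + R) / η :=
      div_nonneg (by linarith [(abs_le.1 (hf θ hθ i)).1]) hη.le
    have p2 : 0 ≤ (f i θ' + R) / η :=
      div_nonneg (by linarith [(abs_le.1 (hf θ' θ'.2 i)).1]) hη.le
    have h3 : |(f i θ + R) / η - (f i θ' + R) / η| < 1 := by
      have a1 := Nat.floor_le p1
      have a2 := Nat.lt_floor_add_one ((f i θ + R) / η)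
      have a3 := Nat.floor_le p2
      have a4 := Nat.lt_floor_add_one ((f i θ' + R) / η)
      rw [e1] at a3 a4
      rw [abs_lt]
      constructor <;> linarith
    rw [← sub_div, abs_div, abs_of_pos hη, div_lt_one hη] at h3
    calc _ = |f i θ + R - (f i θ' + R)| := by congr 1; ring
      _ ≤ η := h3.le

/-! ### Product measures and the law of the model -/

lemma lintegral_pi_prod {ι X : Type*} [Fintype ι] [MeasurableSpace X] (μ : ι → Measure X)
    [∀ i, IsProbabilityMeasure (μ i)] (f : ι → X → ℝ≥0∞) (hf : ∀ i, Measurable (f i)) :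
    ∫⁻ x, ∏ i, f i (x i) ∂(Measure.pi μ) = ∏ i, ∫⁻ x, f i x ∂(μ i) := by
  have hind : iIndepFun (fun i (x : ι → X) => f i (x i)) (Measure.pi μ) :=
    iIndepFun_pi fun i => (hf i).aemeasurable
  rw [lintegral_prod_eq_prod_lintegral_of_indepFun Finset.univ _ hind
    fun i => (hf i).comp (measurable_pi_apply i)]
  refine Finset.prod_congr rfl fun i _ => ?_
  exact (measurePreserving_eval μ i).lintegral_comp (hf i)

lemma lintegral_pi_eval {ι X : Type*} [Fintype ι] [MeasurableSpace X] (μ : ι → Measure X)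
    [∀ i, IsProbabilityMeasure (μ i)] (i : ι) {f : X → ℝ≥0∞} (hf : Measurable f) :
    ∫⁻ x, f (x i) ∂(Measure.pi μ) = ∫⁻ x, f x ∂(μ i) :=
  (measurePreserving_eval μ i).lintegral_comp hf

section Law

variable {ν : Measure ℝ} {b : ℝ → ℝ} {g m n d : ℕ}

/-- Conditional law of the data given the labels. -/
noncomputable def dataLaw (ν : Measure ℝ) (b : ℝ → ℝ) (θ : Param g m) (a : Assign g m n d) :
    Measure (Fin n → Fin d → ℝ) :=
  Measure.pi fun i => Measure.pi fun j => obsLaw ν b (θ.2.2 (a.1 i) (a.2 j))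

lemma law_apply (θ : Param g m) (hA : ∀ k l, IsProbabilityMeasure (obsLaw ν b (θ.2.2 k l)))
    (s : Set (Outcome g m n d)) :
    law ν b n d θ s =
      ∑ a : Assign g m n d, ENNReal.ofReal (labelProb θ a) * dataLaw ν b θ a {x | (a, x) ∈ s} := by
  rw [law, Measure.finsetSum_apply]
  refine Finset.sum_congr rfl fun a _ => ?_
  rw [Measure.smul_apply, smul_eq_mul, Measure.dirac_prod,
    (measurableEmbedding_prodMk_left a).map_apply]
  rfl

lemma isProbabilityMeasure_dataLaw (θ : Param g m)
    (hA : ∀ k l, IsProbabilityMeasure (obsLaw ν b (θ.2.2 k l))) (a : Assign g m n d) :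
    IsProbabilityMeasure (dataLaw ν b θ a) := by
  unfold dataLaw; infer_instance

lemma isProbabilityMeasure_law (θ : Param g m)
    (hA : ∀ k l, IsProbabilityMeasure (obsLaw ν b (θ.2.2 k l)))
    {c : ℝ} (hc : 0 < c) (hθ : InBox c θ) (hπ : ∑ k, θ.1 k = 1) (hρ : ∑ l, θ.2.1 l = 1) :
    IsProbabilityMeasure (law ν b n d θ) := by
  constructor
  rw [law_apply θ hA]
  have : ∀ a : Assign g m n d, dataLaw ν b θ a {x | (a, x) ∈ (univ : Set (Outcome g m n d))} = 1 :=
    fun a => by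
      have := isProbabilityMeasure_dataLaw θ hA a
      simp
  simp only [this, mul_one]
  rw [← ENNReal.ofReal_sum_of_nonneg fun a _ => (labelProb_pos hc hθ a).le,
    sum_labelProb θ hπ hρ, ENNReal.ofReal_one]

open Classical in
lemma law_not_regularEvent_le (θ : Param g m)
    (hA : ∀ k l, IsProbabilityMeasure (obsLaw ν b (θ.2.2 k l)))
    {c : ℝ} (hc : 0 < c) (hθ : InBox c θ) (hπ : ∑ k, θ.1 k = 1) (hρ : ∑ l, θ.2.1 l = 1) :
    law ν b n d θ (regularEvent g m n d c)ᶜ ≤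
      ENNReal.ofReal (g * Real.exp (-(c * (1 / 2 - Real.exp (-1)) * n)) +
        m * Real.exp (-(c * (1 / 2 - Real.exp (-1)) * d))) := by
  refine le_trans ?_ (ENNReal.ofReal_le_ofReal (sum_not_isRegular_le hc hθ hπ hρ))
  rw [law_apply θ hA, ENNReal.ofReal_sum_of_nonneg fun a _ => (labelProb_pos hc hθ a).le,
    Finset.sum_filter]
  refine Finset.sum_le_sum fun a _ => ?_
  have := isProbabilityMeasure_dataLaw θ hA a
  by_cases h : IsRegular (c / 2) a
  · simp [regularEvent, h]
  · simp [regularEvent, h]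

lemma measurableSet_regularEvent (c : ℝ) : MeasurableSet (regularEvent g m n d c) := by
  have : regularEvent g m n d c = Prod.fst ⁻¹' {a | IsRegular (c / 2) a} := rfl
  rw [this]
  exact measurable_fst (Set.toFinite _).measurableSet

/-! ### Square roots of likelihood ratios -/

/-- Square root of the likelihood ratio of `(a, θ)` and `(as, θs)`. -/
noncomputable def sqrtRatio (ν : Measure ℝ) (b : ℝ → ℝ) (θs θ : Param g m)
    (as a : Assign g m n d) (x : Fin n → Fin d → ℝ) : ℝ :=
  √(labelProb θ a / labelProb θs as) *
    ∏ i, ∏ j, Real.exp (((θ.2.2 (a.1 i) (a.2 j) * x i j - psi ν b (θ.2.2 (a.1 i) (a.2 j))) -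
      (θs.2.2 (as.1 i) (as.2 j) * x i j - psi ν b (θs.2.2 (as.1 i) (as.2 j)))) / 2)

/-- The exponent of the affinity of two conditional laws. -/
noncomputable def gapSum (ν : Measure ℝ) (b : ℝ → ℝ) (θs θ : Param g m)
    (as a : Assign g m n d) : ℝ :=
  ∑ i, ∑ j, gap ν b (θs.2.2 (as.1 i) (as.2 j)) (θ.2.2 (a.1 i) (a.2 j))

lemma sqrtRatio_nonneg (θs θ : Param g m) (as a : Assign g m n d) (x : Fin n → Fin d → ℝ) :
    0 ≤ sqrtRatio ν b θs θ as a x :=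
  mul_nonneg (Real.sqrt_nonneg _)
    (Finset.prod_nonneg fun _ _ => Finset.prod_nonneg fun _ _ => Real.exp_nonneg _)

lemma measurable_sqrtRatio (θs θ : Param g m) (as a : Assign g m n d) :
    Measurable (sqrtRatio ν b θs θ as a) := by
  unfold sqrtRatio; fun_prop

/-- Because `sqrtRatio` contains only the exponentials and not the carrier, the identity also holds
at data where `b` vanishes. -/
lemma completeLik_eq_mul_sq_sqrtRatio {c : ℝ} (hc : 0 < c) {θs θ : Param g m} (hθs : InBox c θs)
    (hθ : InBox c θ) (as a : Assign g m n d) (x : Fin n → Fin d → ℝ) :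
    completeLik ν b θ a x = completeLik ν b θs as x * sqrtRatio ν b θs θ as a x ^ 2 := by
  have h1 := labelProb_pos hc hθs as
  have h2 := labelProb_pos hc hθ a
  rw [sqrtRatio, mul_pow, Real.sq_sqrt (div_pos h2 h1).le, ← Finset.prod_pow, completeLik,
    completeLik]
  simp only [← Finset.prod_pow, ← Real.exp_nat_mul]
  rw [show ∀ p q r s : ℝ, p * q * (r * s) = p * r * (q * s) by intros; ring,
    mul_div_cancel₀ _ h1.ne', ← Finset.prod_mul_distrib]
  congr 1
  refine Finset.prod_congr rfl fun i _ => ?_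
  rw [← Finset.prod_mul_distrib]
  refine Finset.prod_congr rfl fun j _ => ?_
  rw [phi, phi, mul_assoc, ← Real.exp_add]
  congr 2
  push_cast
  ring

lemma lintegral_sqrtRatio (hb : Measurable b) (hb0 : ∀ x, 0 ≤ b x) {θs θ : Param g m}
    (hs : ∀ k l, θs.2.2 k l ∈ natParam ν b) (ht : ∀ k l, θ.2.2 k l ∈ natParam ν b)
    (as a : Assign g m n d) :
    ∫⁻ x, ENNReal.ofReal (sqrtRatio ν b θs θ as a x) ∂(dataLaw ν b θs as) =
      ENNReal.ofReal (√(labelProb θ a / labelProb θs as) *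
        Real.exp (-gapSum ν b θs θ as a)) := by
  have hA : ∀ k l, IsProbabilityMeasure (obsLaw ν b (θs.2.2 k l)) :=
    fun k l => isProbabilityMeasure_obsLaw hb hb0 (hs k l)
  simp only [sqrtRatio]
  simp only [ENNReal.ofReal_mul (Real.sqrt_nonneg _)]
  have e1 : ∀ x : Fin n → Fin d → ℝ, ENNReal.ofReal (∏ i, ∏ j,
      Real.exp (((θ.2.2 (a.1 i) (a.2 j) * x i j - psi ν b (θ.2.2 (a.1 i) (a.2 j))) -
      (θs.2.2 (as.1 i) (as.2 j) * x i j - psi ν b (θs.2.2 (as.1 i) (as.2 j)))) / 2)) =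
      ∏ i, ∏ j, ENNReal.ofReal
      (Real.exp (((θ.2.2 (a.1 i) (a.2 j) * x i j - psi ν b (θ.2.2 (a.1 i) (a.2 j))) -
      (θs.2.2 (as.1 i) (as.2 j) * x i j - psi ν b (θs.2.2 (as.1 i) (as.2 j)))) / 2)) := by
    intro x
    rw [ENNReal.ofReal_prod_of_nonneg
      fun _ _ => Finset.prod_nonneg fun _ _ => Real.exp_nonneg _]
    refine Finset.prod_congr rfl fun i _ => ?_
    rw [ENNReal.ofReal_prod_of_nonneg fun _ _ => Real.exp_nonneg _]
  simp only [e1]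
  rw [lintegral_const_mul _ (by fun_prop), dataLaw]
  rw [lintegral_pi_prod _ (fun i (y : Fin d → ℝ) => ∏ j, ENNReal.ofReal
      (Real.exp (((θ.2.2 (a.1 i) (a.2 j) * y j - psi ν b (θ.2.2 (a.1 i) (a.2 j))) -
      (θs.2.2 (as.1 i) (as.2 j) * y j - psi ν b (θs.2.2 (as.1 i) (as.2 j)))) / 2)))
      (fun i => by fun_prop)]
  have e2 : ∀ i, ∫⁻ y, ∏ j, ENNReal.ofReal
      (Real.exp (((θ.2.2 (a.1 i) (a.2 j) * y j - psi ν b (θ.2.2 (a.1 i) (a.2 j))) -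
      (θs.2.2 (as.1 i) (as.2 j) * y j - psi ν b (θs.2.2 (as.1 i) (as.2 j)))) / 2))
      ∂(Measure.pi fun j => obsLaw ν b (θs.2.2 (as.1 i) (as.2 j))) =
      ENNReal.ofReal (Real.exp
        (-∑ j, gap ν b (θs.2.2 (as.1 i) (as.2 j)) (θ.2.2 (a.1 i) (a.2 j)))) := by
    intro i
    rw [lintegral_pi_prod _ (fun j (u : ℝ) => ENNReal.ofReal
      (Real.exp (((θ.2.2 (a.1 i) (a.2 j) * u - psi ν b (θ.2.2 (a.1 i) (a.2 j))) -
      (θs.2.2 (as.1 i) (as.2 j) * u - psi ν b (θs.2.2 (as.1 i) (as.2 j)))) / 2)))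
      (fun j => by fun_prop)]
    simp only [lintegral_exp_half_obsLaw hb hb0 (hs _ _) (ht _ _)]
    rw [← ENNReal.ofReal_prod_of_nonneg fun _ _ => Real.exp_nonneg _, ← Real.exp_sum,
      Finset.sum_neg_distrib]
  simp only [e2]
  rw [← ENNReal.ofReal_prod_of_nonneg fun _ _ => Real.exp_nonneg _, ← Real.exp_sum,
    Finset.sum_neg_distrib, gapSum]

/-- Likelihoods at close parameters are comparable. -/
lemma completeLik_le_exp_mul (hb0 : ∀ x, 0 ≤ b x) {c η : ℝ} (hc : 0 < c) {L : ℝ≥0} {K : Set ℝ}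
    (hL : LipschitzOnWith L (psi ν b) K) {θ θ' : Param g m} (hθ : InBox c θ) (hθ' : InBox c θ')
    (hK : ∀ k l, θ.2.2 k l ∈ K) (hK' : ∀ k l, θ'.2.2 k l ∈ K)
    (h1 : ∀ k, |θ.1 k - θ'.1 k| ≤ η) (h2 : ∀ l, |θ.2.1 l - θ'.2.1 l| ≤ η)
    (h3 : ∀ k l, |θ.2.2 k l - θ'.2.2 k l| ≤ η) (a : Assign g m n d) (x : Fin n → Fin d → ℝ) :
    completeLik ν b θ a x ≤
      Real.exp (η / c * (n + d) + η * (∑ i, ∑ j, |x i j|) + L * η * (n * d)) *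
        completeLik ν b θ' a x := by
  have hprob : ∀ p q : ℝ, |p - q| ≤ η → c ≤ q → p ≤ Real.exp (η / c) * q := by
    intro p q hpq hq
    have hη : 0 ≤ η := (abs_nonneg _).trans hpq
    have e1 := Real.add_one_le_exp (η / c)
    have e2 : η ≤ η / c * q := by
      rw [div_mul_eq_mul_div, le_div_iff₀ hc]; gcongr
    have e3 := (abs_le.1 hpq).2
    nlinarith [hc.trans_le hq]
  have hrow : ∏ i, θ.1 (a.1 i) ≤ Real.exp (η / c * n) * ∏ i, θ'.1 (a.1 i) := by
    calc _ ≤ ∏ i, (Real.exp (η / c) * θ'.1 (a.1 i)) :=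
          Finset.prod_le_prod (fun i _ => hc.le.trans (hθ.1 _).1)
            fun i _ => hprob _ _ (h1 _) (hθ'.1 _).1
      _ = _ := by
          rw [Finset.prod_mul_distrib, Finset.prod_const, ← Real.exp_nat_mul]
          simp [mul_comm]
  have hcol : ∏ j, θ.2.1 (a.2 j) ≤ Real.exp (η / c * d) * ∏ j, θ'.2.1 (a.2 j) := by
    calc _ ≤ ∏ j, (Real.exp (η / c) * θ'.2.1 (a.2 j)) :=
          Finset.prod_le_prod (fun j _ => hc.le.trans (hθ.2 _).1)
            fun j _ => hprob _ _ (h2 _) (hθ'.2 _).1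
      _ = _ := by
          rw [Finset.prod_mul_distrib, Finset.prod_const, ← Real.exp_nat_mul]
          simp [mul_comm]
  -- The exponent is linear in the parameter with slope `x i j`, up to the Lipschitz function `psi`.
  have hphi : ∀ i j, phi ν b (x i j) (θ.2.2 (a.1 i) (a.2 j)) ≤
      Real.exp (η * |x i j| + L * η) * phi ν b (x i j) (θ'.2.2 (a.1 i) (a.2 j)) := by
    intro i j
    rw [phi, phi, mul_left_comm, ← Real.exp_add]
    refine mul_le_mul_of_nonneg_left (Real.exp_le_exp.2 ?_) (hb0 _)
    have e1 := hL.dist_le_mul _ (hK (a.1 i) (a.2 j)) _ (hK' (a.1 i) (a.2 j))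
    rw [Real.dist_eq, Real.dist_eq] at e1
    have e2 : (L : ℝ) * |θ.2.2 (a.1 i) (a.2 j) - θ'.2.2 (a.1 i) (a.2 j)| ≤ L * η := by
      gcongr; exact h3 _ _
    have e3 := (abs_le.1 (e1.trans e2)).1
    have e4 : (θ.2.2 (a.1 i) (a.2 j) - θ'.2.2 (a.1 i) (a.2 j)) * x i j ≤ η * |x i j| := by
      refine (le_abs_self _).trans ?_
      rw [abs_mul]
      gcongr
      exact h3 _ _
    linarith
  have hphi0 : ∀ u t, 0 ≤ phi ν b u t := fun u t => mul_nonneg (hb0 _) (Real.exp_nonneg _)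
  have hdata : ∏ i, ∏ j, phi ν b (x i j) (θ.2.2 (a.1 i) (a.2 j)) ≤
      Real.exp (η * (∑ i, ∑ j, |x i j|) + L * η * (n * d)) *
        ∏ i, ∏ j, phi ν b (x i j) (θ'.2.2 (a.1 i) (a.2 j)) := by
    calc _ ≤ ∏ i, ∏ j,
          (Real.exp (η * |x i j| + L * η) * phi ν b (x i j) (θ'.2.2 (a.1 i) (a.2 j))) :=
          Finset.prod_le_prod (fun i _ => Finset.prod_nonneg fun j _ => hphi0 _ _) fun i _ =>
            Finset.prod_le_prod (fun j _ => hphi0 _ _) fun j _ => hphi i j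
      _ = _ := by
          simp only [Finset.prod_mul_distrib, ← Real.exp_sum, Finset.sum_add_distrib,
            ← Finset.mul_sum]
          congr 2
          simp
          ring
  unfold completeLik labelProb
  calc _ ≤ (Real.exp (η / c * n) * ∏ i, θ'.1 (a.1 i)) *
        (Real.exp (η / c * d) * ∏ j, θ'.2.1 (a.2 j)) *
        (Real.exp (η * (∑ i, ∑ j, |x i j|) + L * η * (n * d)) *
        ∏ i, ∏ j, phi ν b (x i j) (θ'.2.2 (a.1 i) (a.2 j))) := by
        have p1 : 0 ≤ ∏ i, θ.1 (a.1 i) := Finset.prod_nonneg fun i _ => hc.le.trans (hθ.1 _).1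
        have p2 : 0 ≤ ∏ j, θ.2.1 (a.2 j) := Finset.prod_nonneg fun i _ => hc.le.trans (hθ.2 _).1
        have p3 : 0 ≤ ∏ i, ∏ j, phi ν b (x i j) (θ.2.2 (a.1 i) (a.2 j)) :=
          Finset.prod_nonneg fun i _ => Finset.prod_nonneg fun j _ => hphi0 _ _
        have p1' := p1.trans hrow
        exact mul_le_mul (mul_le_mul hrow hcol p2 p1') hdata p3
          (mul_nonneg p1' (p2.trans hcol))
    _ = _ := by
        rw [show η / c * (n + d) + η * (∑ i, ∑ j, |x i j|) + L * η * (n * d) =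
          η / c * n + η / c * d + (η * (∑ i, ∑ j, |x i j|) + L * η * (n * d)) by ring,
          Real.exp_add (η / c * n + η / c * d), Real.exp_add (η / c * n)]
        ring

end Law

/-! ### The probability that inequivalent assignments matter -/

section Exceedance

variable {ν : Measure ℝ} {b : ℝ → ℝ} {g m n d : ℕ}

open Classical in
/-- The assignments that are not equivalent to `as`. -/
noncomputable def inequivalent (as : Assign g m n d) : Finset (Assign g m n d) :=
  Finset.univ.filter fun a => ¬ AssignEquiv a as

/-- Sum of `p(z, w, x; θ)` over all the assignments not equivalent to the true one. -/
noncomputable def inequivalentSum (ν : Measure ℝ) (b : ℝ → ℝ) (θ : Param g m)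
    (ω : Outcome g m n d) : ℝ :=
  ∑ a ∈ inequivalent ω.1, completeLik ν b θ a ω.2

lemma completeLik_nonneg (hb0 : ∀ x, 0 ≤ b x) {c : ℝ} (hc : 0 < c) {θ : Param g m}
    (hθ : InBox c θ) (a : Assign g m n d) (x : Fin n → Fin d → ℝ) :
    0 ≤ completeLik ν b θ a x :=
  mul_nonneg (labelProb_pos hc hθ a).le (Finset.prod_nonneg fun _ _ =>
    Finset.prod_nonneg fun _ _ => mul_nonneg (hb0 _) (Real.exp_nonneg _))

/-- This replaces an event about a supremum over `Θ` by one about a finite sum of square roots, to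
which Markov's inequality applies. -/
lemma sqrt_le_sum_sqrtRatio (hb0 : ∀ x, 0 ≤ b x) {c : ℝ} (hc : 0 < c) {θs : Param g m}
    (hθs : InBox c θs) {Θ : Set (Param g m)} (hΘ : ∀ θ ∈ Θ, InBox c θ) {T : Finset (Param g m)}
    (hT : ∀ θ ∈ T, θ ∈ Θ) {as : Assign g m n d} {x : Fin n → Fin d → ℝ} {C₀ ε : ℝ}
    (hnet : ∀ θ ∈ Θ, ∃ θ' ∈ T, ∀ a : Assign g m n d,
      completeLik ν b θ a x ≤ Real.exp C₀ * completeLik ν b θ' a x)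
    (hx : ENNReal.ofReal (ε * completeLik ν b θs as x) <
      ⨆ θ ∈ Θ, ENNReal.ofReal (inequivalentSum ν b θ (as, x))) :
    √(ε * Real.exp (-C₀)) ≤ ∑ θ ∈ T, ∑ a ∈ inequivalent as, sqrtRatio ν b θs θ as a x := by
  simp only [lt_iSup_iff] at hx
  obtain ⟨θ, hθ, hlt⟩ := hx
  have hlt' : ε * completeLik ν b θs as x < inequivalentSum ν b θ (as, x) :=
    lt_of_not_ge fun h => absurd (ENNReal.ofReal_le_ofReal h) (not_le.2 hlt)
  obtain ⟨θ', hθ', hle⟩ := hnet θ hθ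
  set R := completeLik ν b θs as x
  have hR : 0 ≤ R := completeLik_nonneg hb0 hc hθs as x
  set r : Assign g m n d → ℝ := fun a => sqrtRatio ν b θs θ' as a x
  have hr : ∀ a, 0 ≤ r a := fun a => sqrtRatio_nonneg _ _ _ _ _
  have h1 : inequivalentSum ν b θ (as, x) ≤
      R * (Real.exp C₀ * ∑ a ∈ inequivalent as, r a ^ 2) := by
    unfold inequivalentSum
    calc _ ≤ ∑ a ∈ inequivalent as, Real.exp C₀ * completeLik ν b θ' a x :=
          Finset.sum_le_sum fun a _ => hle a
      _ = _ := by
          simp only [Finset.mul_sum]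
          refine Finset.sum_congr rfl fun a _ => ?_
          rw [completeLik_eq_mul_sq_sqrtRatio hc hθs (hΘ _ (hT _ hθ')) as a x]
          ring
  have h2 : R * ε < R * (Real.exp C₀ * ∑ a ∈ inequivalent as, r a ^ 2) := by
    rw [mul_comm R ε]; exact hlt'.trans_le h1
  -- The strict inequality allows `R` to be cancelled without first ruling out `R = 0`.
  have h3 := lt_of_mul_lt_mul_left h2 hR
  have h4 : ∑ a ∈ inequivalent as, r a ^ 2 ≤ (∑ a ∈ inequivalent as, r a) ^ 2 :=
    Finset.sum_sq_le_sq_sum_of_nonneg fun a _ => hr a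
  have h5 : ∑ a ∈ inequivalent as, r a ≤
      ∑ θ ∈ T, ∑ a ∈ inequivalent as, sqrtRatio ν b θs θ as a x :=
    Finset.single_le_sum (f := fun θ => ∑ a ∈ inequivalent as, sqrtRatio ν b θs θ as a x)
      (fun θ _ => Finset.sum_nonneg fun a _ => sqrtRatio_nonneg _ _ _ _ _) hθ'
  refine le_trans (Real.sqrt_le_iff.2 ⟨Finset.sum_nonneg fun a _ => hr a, ?_⟩) h5
  rw [Real.exp_neg, mul_inv_le_iff₀ (Real.exp_pos _), mul_comm]
  exact h3.le.trans (mul_le_mul_of_nonneg_left h4 (Real.exp_nonneg _))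

/-- Markov's inequality for a sum of mean at most `A n d`. The threshold `(n d)²` is the inverse of
the mesh of the net, so below it the data term in the comparison of likelihoods stays bounded. -/
lemma dataLaw_large_le (θs : Param g m)
    (hA : ∀ k l, IsProbabilityMeasure (obsLaw ν b (θs.2.2 k l))) {A : ℝ}
    (habs : ∀ k l, ∫⁻ x, ENNReal.ofReal |x| ∂(obsLaw ν b (θs.2.2 k l)) ≤ ENNReal.ofReal A)
    (hn : 0 < n) (hd : 0 < d) (as : Assign g m n d) :
    dataLaw ν b θs as {x | ((n : ℝ) * d) ^ 2 ≤ ∑ i, ∑ j, |x i j|} ≤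
      ENNReal.ofReal (A / (n * d)) := by
  have hnd : (0 : ℝ) < n * d := by positivity
  have hsub : {x : Fin n → Fin d → ℝ | ((n : ℝ) * d) ^ 2 ≤ ∑ i, ∑ j, |x i j|} ⊆
      {x | ENNReal.ofReal (((n : ℝ) * d) ^ 2) ≤ ∑ i, ∑ j, ENNReal.ofReal |x i j|} := by
    intro x hx
    have := ENNReal.ofReal_le_ofReal hx
    rw [ENNReal.ofReal_sum_of_nonneg
      fun _ _ => Finset.sum_nonneg fun _ _ => abs_nonneg _] at this
    simp only [ENNReal.ofReal_sum_of_nonneg fun _ _ => abs_nonneg _] at this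
    exact this
  refine (measure_mono hsub).trans ?_
  refine (meas_ge_le_lintegral_div (Measurable.aemeasurable (by fun_prop))
    (ENNReal.ofReal_pos.2 (by positivity)).ne'
    ENNReal.ofReal_ne_top).trans ?_
  have hint : ∫⁻ x, ∑ i, ∑ j, ENNReal.ofReal |x i j| ∂(dataLaw ν b θs as) ≤
      ENNReal.ofReal (n * d * A) := by
    rw [lintegral_finsetSum _ fun i _ => by fun_prop]
    calc _ ≤ ∑ _i : Fin n, ∑ _j : Fin d, ENNReal.ofReal A := by
          refine Finset.sum_le_sum fun i _ => ?_
          rw [lintegral_finsetSum _ fun j _ => by fun_prop]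
          refine Finset.sum_le_sum fun j _ => ?_
          rw [dataLaw, lintegral_pi_eval _ i
            (f := fun y : Fin d → ℝ => ENNReal.ofReal |y j|) (by fun_prop),
            lintegral_pi_eval _ j (f := fun u : ℝ => ENNReal.ofReal |u|) (by fun_prop)]
          exact habs _ _
      _ = _ := by
          simp [ENNReal.ofReal_mul, mul_assoc]
  calc _ ≤ ENNReal.ofReal (n * d * A) / ENNReal.ofReal ((n * d) ^ 2) := by gcongr
    _ = _ := by
        rw [← ENNReal.ofReal_div_of_pos (by positivity)]
        congr 1
        field_simp

open Classical in
/-- Bound for the probability that the inequivalent assignments contribute more than `ε` times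
the true complete likelihood. -/
lemma law_exceedance_le (hb : Measurable b) (hb0 : ∀ x, 0 ≤ b x) {c : ℝ} (hc : 0 < c)
    {Θ : Set (Param g m)} {K : Set ℝ} (hK : K ⊆ natParam ν b) (hΘ : ∀ θ ∈ Θ, InBox c θ)
    (hπ : ∀ θ ∈ Θ, ∑ k, θ.1 k = 1) (hρ : ∀ θ ∈ Θ, ∑ l, θ.2.1 l = 1)
    (hΘK : ∀ θ ∈ Θ, ∀ k l, θ.2.2 k l ∈ K) {θs : Param g m} (hθs : θs ∈ Θ)
    {L : ℝ≥0} (hL : LipschitzOnWith L (psi ν b) K) {A : ℝ} (hA0 : 0 ≤ A)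
    (habs : ∀ k l, ∫⁻ x, ENNReal.ofReal |x| ∂(obsLaw ν b (θs.2.2 k l)) ≤ ENNReal.ofReal A)
    {B : ℝ} (hcost : ∀ θ ∈ Θ, ∀ as : Assign g m n d, IsRegular (c / 2) as → ∀ a,
      ∃ (σ : Equiv.Perm (Fin g)) (τ : Equiv.Perm (Fin m)),
      B * (d * hamming a.1 (σ ∘ as.1) + n * hamming a.2 (τ ∘ as.2)) ≤ gapSum ν b θs θ as a)
    (hn : 0 < n) (hd : 0 < d) {T : Finset (Param g m)} (hT : ∀ θ ∈ T, θ ∈ Θ)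
    (hnet : ∀ θ ∈ Θ, ∃ θ' ∈ T, (∀ k, |θ.1 k - θ'.1 k| ≤ (((n : ℝ) * d) ^ 2)⁻¹) ∧
      (∀ l, |θ.2.1 l - θ'.2.1 l| ≤ (((n : ℝ) * d) ^ 2)⁻¹) ∧
      ∀ k l, |θ.2.2 k l - θ'.2.2 k l| ≤ (((n : ℝ) * d) ^ 2)⁻¹) {ε : ℝ} (hε : 0 < ε) :
    law ν b n d θs {ω | ENNReal.ofReal (ε * completeLik ν b θs ω.1 ω.2) <
      ⨆ θ ∈ Θ, ENNReal.ofReal (inequivalentSum ν b θ ω)} ≤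
    law ν b n d θs (regularEvent g m n d c)ᶜ + (ENNReal.ofReal (A / (n * d)) +
      ENNReal.ofReal ((√(ε * Real.exp (-(2 / c + 1 + L))))⁻¹ * (T.card *
        ((g.factorial * m.factorial : ℕ) *
        (Real.exp (g * n * ((√c)⁻¹ * Real.exp (-(B * d))) +
          m * d * ((√c)⁻¹ * Real.exp (-(B * n)))) - 1))))) := by
  have hA : ∀ k l, IsProbabilityMeasure (obsLaw ν b (θs.2.2 k l)) :=
    fun k l => isProbabilityMeasure_obsLaw hb hb0 (hK (hΘK _ hθs k l))
  set E : Set (Outcome g m n d) := {ω | ENNReal.ofReal (ε * completeLik ν b θs ω.1 ω.2) <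
      ⨆ θ ∈ Θ, ENNReal.ofReal (inequivalentSum ν b θ ω)}
  have hsplit : E ⊆ (regularEvent g m n d c)ᶜ ∪ (E ∩ regularEvent g m n d c) := by
    intro ω hω
    by_cases h : ω ∈ regularEvent g m n d c
    · exact Or.inr ⟨hω, h⟩
    · exact Or.inl h
  refine ((measure_mono hsplit).trans (measure_union_le _ _)).trans (add_le_add le_rfl ?_)
  -- At mesh `(n d)⁻²` the three summands bound the contributions of the mixing proportions, of the
  -- data and of `psi`.
  set C₀ : ℝ := 2 / c + 1 + L
  set κ : ℝ := √(ε * Real.exp (-C₀))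
  have hκ : 0 < κ := Real.sqrt_pos.2 (by positivity)
  have hnd : (1 : ℝ) ≤ n * d := by exact_mod_cast Nat.mul_pos hn hd
  have hn1 : (1 : ℝ) ≤ n := by exact_mod_cast hn
  have hd1 : (1 : ℝ) ≤ d := by exact_mod_cast hd
  -- the conditional probability given regular labels
  have hslice : ∀ as : Assign g m n d, IsRegular (c / 2) as →
      dataLaw ν b θs as {x | (as, x) ∈ E} ≤ ENNReal.ofReal (A / (n * d)) +
        ENNReal.ofReal (κ⁻¹ * ∑ θ ∈ T, ∑ a ∈ inequivalent as,
          √(labelProb θ a / labelProb θs as) * Real.exp (-gapSum ν b θs θ as a)) := by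
    intro as _
    have hsub : {x | (as, x) ∈ E} ⊆ {x | ((n : ℝ) * d) ^ 2 ≤ ∑ i, ∑ j, |x i j|} ∪
        {x | ENNReal.ofReal κ ≤
          ∑ θ ∈ T, ∑ a ∈ inequivalent as, ENNReal.ofReal (sqrtRatio ν b θs θ as a x)} := by
      intro x hx
      rcases le_or_gt (((n : ℝ) * d) ^ 2) (∑ i, ∑ j, |x i j|) with h | h
      · exact Or.inl h
      right
      have hmain := sqrt_le_sum_sqrtRatio hb0 hc (hΘ _ hθs) hΘ hT (C₀ := C₀) (fun θ hθ => by
        obtain ⟨θ', hθ', h1, h2, h3⟩ := hnet θ hθ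
        refine ⟨θ', hθ', fun a => ?_⟩
        refine (completeLik_le_exp_mul hb0 hc hL (hΘ _ hθ) (hΘ _ (hT _ hθ')) (hΘK _ hθ)
          (hΘK _ (hT _ hθ')) h1 h2 h3 a x).trans ?_
        refine mul_le_mul_of_nonneg_right (Real.exp_le_exp.2 ?_)
          (completeLik_nonneg hb0 hc (hΘ _ (hT _ hθ')) a x)
        have hN : (0 : ℝ) < ((n : ℝ) * d) ^ 2 := by positivity
        have t1 : (((n : ℝ) * d) ^ 2)⁻¹ / c * (n + d) ≤ 2 / c := by
          rw [div_mul_eq_mul_div]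
          refine div_le_div_of_nonneg_right ?_ hc.le
          rw [inv_mul_le_iff₀ hN]
          nlinarith
        have t2 : (((n : ℝ) * d) ^ 2)⁻¹ * (∑ i, ∑ j, |x i j|) ≤ 1 := by
          rw [inv_mul_le_iff₀ hN]; linarith
        have t3 : (L : ℝ) * (((n : ℝ) * d) ^ 2)⁻¹ * (n * d) ≤ L := by
          rw [mul_assoc]
          refine mul_le_of_le_one_right L.2 ?_
          rw [inv_mul_le_iff₀ hN]
          nlinarith
        simp only [C₀]
        linarith) hx
      have := ENNReal.ofReal_le_ofReal hmain
      rw [ENNReal.ofReal_sum_of_nonneg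
        fun _ _ => Finset.sum_nonneg fun _ _ => sqrtRatio_nonneg _ _ _ _ _] at this
      simp only [ENNReal.ofReal_sum_of_nonneg fun _ _ => sqrtRatio_nonneg _ _ _ _ _] at this
      exact this
    refine ((measure_mono hsub).trans (measure_union_le _ _)).trans
      (add_le_add (dataLaw_large_le θs hA habs hn hd as) ?_)
    refine (meas_ge_le_lintegral_div (Measurable.aemeasurable ?_) (by simpa using hκ)
      ENNReal.ofReal_ne_top).trans (le_of_eq ?_)
    · exact Finset.measurable_sum _ fun θ _ => Finset.measurable_sum _ fun a _ =>
        (measurable_sqrtRatio _ _ _ _).ennreal_ofReal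
    · rw [lintegral_finsetSum _ fun θ _ => Finset.measurable_sum _ fun a _ =>
        (measurable_sqrtRatio _ _ _ _).ennreal_ofReal]
      rw [inv_mul_eq_div, ENNReal.ofReal_div_of_pos hκ, ENNReal.ofReal_sum_of_nonneg
        fun _ _ => Finset.sum_nonneg fun _ _ => by positivity]
      congr 1
      refine Finset.sum_congr rfl fun θ hθ => ?_
      rw [lintegral_finsetSum _ fun a _ => (measurable_sqrtRatio _ _ _ _).ennreal_ofReal,
        ENNReal.ofReal_sum_of_nonneg fun _ _ => by positivity]
      refine Finset.sum_congr rfl fun a _ => ?_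
      exact lintegral_sqrtRatio hb hb0 (fun k l => hK (hΘK _ hθs k l))
        (fun k l => hK (hΘK _ (hT _ hθ) k l)) as a
  set S : Finset (Assign g m n d) := Finset.univ.filter fun as => IsRegular (c / 2) as
  have hlp : ∀ as : Assign g m n d, 0 < labelProb θs as := fun as => labelProb_pos hc (hΘ _ hθs) as
  have hterm0 : ∀ as : Assign g m n d, 0 ≤ ∑ θ ∈ T, ∑ a ∈ inequivalent as,
      √(labelProb θ a / labelProb θs as) * Real.exp (-gapSum ν b θs θ as a) :=
    fun as => Finset.sum_nonneg fun _ _ => Finset.sum_nonneg fun _ _ => by positivity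
  have hAnd : 0 ≤ A / (n * d) := by positivity
  -- Averaging over the true labels turns the square root of a ratio into a geometric mean, the form
  -- required by `sum_affinity_le`.
  have hsqrt : ∀ (as a : Assign g m n d) (θ : Param g m),
      labelProb θs as * √(labelProb θ a / labelProb θs as) =
        √(labelProb θs as * labelProb θ a) := by
    intro as a θ
    have h1 : labelProb θs as * labelProb θ a =
        labelProb θs as ^ 2 * (labelProb θ a / labelProb θs as) := by
      have := (hlp as).ne'
      field_simp
    rw [h1, Real.sqrt_mul (sq_nonneg _), Real.sqrt_sq (hlp as).le]
  rw [law_apply θs hA, ← ENNReal.ofReal_add hAnd]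
  · calc _ ≤ ∑ as ∈ S, ENNReal.ofReal (labelProb θs as * (A / (n * d) +
          κ⁻¹ * ∑ θ ∈ T, ∑ a ∈ inequivalent as,
          √(labelProb θ a / labelProb θs as) * Real.exp (-gapSum ν b θs θ as a))) := by
          rw [Finset.sum_filter]
          refine Finset.sum_le_sum fun as _ => ?_
          split_ifs with h
          · rw [ENNReal.ofReal_mul (hlp as).le, ENNReal.ofReal_add hAnd
              (mul_nonneg (by positivity) (hterm0 as))]
            refine mul_le_mul_right ((measure_mono ?_).trans (hslice as h)) _
            exact fun x hx => hx.1
          · have : {x | (as, x) ∈ E ∩ regularEvent g m n d c} = ∅ := by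
              ext x
              simp [regularEvent, h]
            rw [this]; simp
      _ = ENNReal.ofReal (∑ as ∈ S, labelProb θs as * (A / (n * d) +
          κ⁻¹ * ∑ θ ∈ T, ∑ a ∈ inequivalent as,
          √(labelProb θ a / labelProb θs as) * Real.exp (-gapSum ν b θs θ as a))) := by
          rw [ENNReal.ofReal_sum_of_nonneg]
          exact fun as _ => mul_nonneg (hlp as).le
            (add_nonneg hAnd (mul_nonneg (by positivity) (hterm0 as)))
      _ ≤ _ := by
          refine ENNReal.ofReal_le_ofReal ?_
          simp only [mul_add, Finset.sum_add_distrib, ← Finset.sum_mul]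
          refine add_le_add ?_ ?_
          · refine mul_le_of_le_one_left hAnd ?_
            rw [← sum_labelProb (n := n) (d := d) θs (hπ _ hθs) (hρ _ hθs)]
            exact Finset.sum_le_univ_sum_of_nonneg fun as => (hlp as).le
          · have e1 : ∀ as : Assign g m n d, labelProb θs as * (κ⁻¹ * ∑ θ ∈ T, ∑ a ∈ inequivalent as,
                √(labelProb θ a / labelProb θs as) * Real.exp (-gapSum ν b θs θ as a)) =
                κ⁻¹ * ∑ θ ∈ T, ∑ a ∈ inequivalent as,
                √(labelProb θs as * labelProb θ a) * Real.exp (-gapSum ν b θs θ as a) := by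
              intro as
              rw [mul_left_comm]
              congr 1
              simp only [Finset.mul_sum, ← mul_assoc, hsqrt]
            simp only [e1]
            rw [← Finset.mul_sum, Finset.sum_comm]
            refine mul_le_mul_of_nonneg_left ?_ (by positivity)
            rw [← nsmul_eq_mul]
            refine Finset.sum_le_card_nsmul _ _ _ fun θ hθ => ?_
            refine sum_affinity_le hc (hΘ _ hθs) (hΘ _ (hT _ hθ)) (hπ _ hθs) (hρ _ hθs)
              (hπ _ (hT _ hθ)) (hρ _ (hT _ hθ)) (gapSum ν b θs θ) S
              (fun as has a => hcost θ (hT _ hθ) as (Finset.mem_filter.1 has).2 a)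
              inequivalent fun as a ha => (Finset.mem_filter.1 ha).2
  · have : (0 : ℝ) ≤ g * n * ((√c)⁻¹ * Real.exp (-(B * d))) +
          m * d * ((√c)⁻¹ * Real.exp (-(B * n))) := by positivity
    have h2 := Real.one_le_exp this
    have : (0 : ℝ) ≤ Real.exp (g * n * ((√c)⁻¹ * Real.exp (-(B * d))) +
          m * d * ((√c)⁻¹ * Real.exp (-(B * n)))) - 1 := by linarith
    positivity

end Exceedance

/-! ### Asymptotics -/

section Asymptotics

/-- Exponential decay in `d` beats every power of `n` and `d` as soon as `log n = o(d)`. -/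
lemma tendsto_pow_mul_exp_neg {n d : ℕ → ℕ} (hn : Tendsto n atTop atTop)
    (hd : Tendsto d atTop atTop) (hlog : Tendsto (fun N => Real.log (n N) / d N) atTop (𝓝 0))
    {B : ℝ} (hB : 0 < B) (p : ℕ) :
    Tendsto (fun N => ((n N : ℝ) * d N) ^ p * (n N * Real.exp (-(B * d N)))) atTop (𝓝 0) := by
  have hdR : Tendsto (fun N => (d N : ℝ)) atTop atTop := tendsto_natCast_atTop_atTop.comp hd
  have hlogd : Tendsto (fun N => Real.log (d N) / d N) atTop (𝓝 0) := by
    have := Real.isLittleO_log_id_atTop.tendsto_div_nhds_zero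
    exact this.comp hdR
  -- This is the logarithm of the quantity, with `d N` factored out; the bracket tends to `-B`.
  have hexp : Tendsto (fun N => (d N : ℝ) * ((p + 1) * (Real.log (n N) / d N) +
      p * (Real.log (d N) / d N) - B)) atTop atBot := by
    refine hdR.atTop_mul_neg (C := -B) (by linarith) ?_
    have := ((hlog.const_mul ((p : ℝ) + 1)).add (hlogd.const_mul (p : ℝ))).sub_const B
    simpa using this
  refine (Real.tendsto_exp_atBot.comp hexp).congr' ?_
  filter_upwards [hn.eventually_gt_atTop 0, hd.eventually_gt_atTop 0] with N h1 h2
  have h1' : (0 : ℝ) < n N := by exact_mod_cast h1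
  have h2' : (0 : ℝ) < d N := by exact_mod_cast h2
  have e : (d N : ℝ) * ((p + 1) * (Real.log (n N) / d N) + p * (Real.log (d N) / d N) - B) =
      p * (Real.log (n N) + Real.log (d N)) + (Real.log (n N) + -(B * d N)) := by
    field_simp; ring
  rw [Function.comp_apply, e, Real.exp_add, Real.exp_nat_mul, Real.exp_add, Real.exp_add,
    Real.exp_log h1', Real.exp_log h2']

/-- The expected contribution of the inequivalent assignments is smaller than every power. -/
lemma tendsto_pow_mul_exp_sub_one {n d : ℕ → ℕ} (hn : Tendsto n atTop atTop)
    (hd : Tendsto d atTop atTop) (hlog : Tendsto (fun N => Real.log (d N) / n N) atTop (𝓝 0))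
    (hlog' : Tendsto (fun N => Real.log (n N) / d N) atTop (𝓝 0))
    {B : ℝ} (hB : 0 < B) (p g m : ℕ) (κ : ℝ) :
    Tendsto (fun N => ((n N : ℝ) * d N) ^ p *
      (Real.exp (g * n N * (κ * Real.exp (-(B * d N))) +
        m * d N * (κ * Real.exp (-(B * n N)))) - 1)) atTop (𝓝 0) := by
  have hy : ∀ q : ℕ, Tendsto (fun N => ((n N : ℝ) * d N) ^ q *
      (g * n N * (κ * Real.exp (-(B * d N))) + m * d N * (κ * Real.exp (-(B * n N)))))
      atTop (𝓝 0) := by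
    intro q
    have h1 := (tendsto_pow_mul_exp_neg hn hd hlog' hB q).const_mul (g * κ)
    have h2 := (tendsto_pow_mul_exp_neg hd hn hlog hB q).const_mul (m * κ)
    have h := h1.add h2
    simp only [mul_zero, add_zero] at h
    refine h.congr fun N => ?_
    rw [mul_comm (d N : ℝ) (n N : ℝ)]
    ring
  -- The case `q = 0` makes the exponent eventually at most one in absolute value, where `|exp y -
  -- 1| ≤ 2 |y|`; the case `q = p` then concludes.
  have hy0 := hy 0
  simp only [pow_zero, one_mul] at hy0
  have hy0' := hy0.abs
  have hprod := ((hy p).abs.mul_const 2)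
  simp only [abs_zero, zero_mul] at hprod
  refine squeeze_zero_norm' ?_ hprod
  simp only [abs_zero] at hy0'
  have hev := hy0'.eventually_le_const zero_lt_one
  filter_upwards [hev] with N hN
  have h1 := mul_le_mul_of_nonneg_left (Real.abs_exp_sub_one_le hN)
    (abs_nonneg (((n N : ℝ) * d N) ^ p))
  rw [Real.norm_eq_abs, abs_mul, abs_mul]
  linarith

/-- Size of the net of mesh `(nd)⁻²`. -/
lemma net_card_bound {R M : ℝ} (hR : 1 ≤ R) (hM : 1 ≤ M) (p : ℕ) :
    (((⌊2 * R / (M ^ 2)⁻¹⌋₊ + 1) ^ p : ℕ) : ℝ) ≤ (3 * R) ^ p * M ^ (2 * p) := by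
  rw [pow_mul, ← mul_pow]
  push_cast
  refine pow_le_pow_left₀ (by positivity) ?_ p
  have h1 : (⌊2 * R / (M ^ 2)⁻¹⌋₊ : ℝ) ≤ 2 * R / (M ^ 2)⁻¹ := Nat.floor_le (by positivity)
  rw [div_inv_eq_mul] at h1
  have h2 : 1 ≤ R * M ^ 2 := by
    have := one_le_pow₀ (n := 2) hM
    nlinarith
  rw [div_inv_eq_mul]
  linarith

/-! ### Monotonicity of the stochastic order symbol, and conditioning -/

section Stochastic

variable {E : Type*} {S : ℕ → Type*} [∀ N, MeasurableSpace (S N)] {μ : ∀ N, Measure (S N)}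
  {Θ : Set E} {Y Y' : ∀ N, E → S N → ℝ} {R : ∀ N, S N → ℝ}

lemma SupIsLittleOP.mono (h : SupIsLittleOP μ Θ Y' R)
    (hY : ∀ᶠ N in atTop, ∀ θ ∈ Θ, ∀ ω, Y N θ ω ≤ Y' N θ ω) : SupIsLittleOP μ Θ Y R := by
  intro ε hε
  refine tendsto_of_tendsto_of_tendsto_of_le_of_le' tendsto_const_nhds (h ε hε)
    (Eventually.of_forall fun _ => zero_le) ?_
  filter_upwards [hY] with N hN
  refine measure_mono fun ω hω => ?_
  simp only [mem_ofPred_eq] at hω ⊢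
  refine lt_of_lt_of_le hω ?_
  exact iSup₂_mono fun θ hθ => ENNReal.ofReal_le_ofReal (hN θ hθ ω)

/-- Conditioning on an event of probability at least one half at most doubles every probability. -/
lemma SupIsLittleOP.cond [∀ N, IsProbabilityMeasure (μ N)] (h : SupIsLittleOP μ Θ Y R)
    {A : ∀ N, Set (S N)} (hA : ∀ N, MeasurableSet (A N))
    (hlim : Tendsto (fun N => μ N (A N)ᶜ) atTop (𝓝 0)) :
    SupIsLittleOP (fun N => (μ N)[|A N]) Θ Y R := by
  intro ε hε
  have h2 := ENNReal.Tendsto.const_mul (a := 2) (h ε hε) (Or.inr (by simp))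
  rw [mul_zero] at h2
  refine tendsto_of_tendsto_of_tendsto_of_le_of_le' tendsto_const_nhds h2
    (Eventually.of_forall fun _ => zero_le) ?_
  have hhalf : ∀ᶠ N in atTop, μ N (A N)ᶜ ≤ 2⁻¹ := by
    refine hlim.eventually_le_const ?_
    simp
  filter_upwards [hhalf] with N hN
  rw [cond_apply (hA N)]
  refine mul_le_mul' ?_ (measure_mono inter_subset_right)
  rw [ENNReal.inv_le_iff_inv_le]
  have h1 : μ N (A N) = 1 - μ N (A N)ᶜ := by
    rw [← prob_compl_eq_one_sub (hA N).compl, compl_compl]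
  rw [h1]
  calc (2 : ℝ≥0∞)⁻¹ = 1 - 2⁻¹ := ENNReal.one_sub_inv_two.symm
    _ ≤ _ := tsub_le_tsub_left hN _

end Stochastic

variable {ν : Measure ℝ} {b : ℝ → ℝ} {g m : ℕ}

lemma tendsto_law_not_regularEvent {θ : Param g m}
    (hA : ∀ k l, IsProbabilityMeasure (obsLaw ν b (θ.2.2 k l)))
    {c : ℝ} (hc : 0 < c) (hθ : InBox c θ) (hπ : ∑ k, θ.1 k = 1) (hρ : ∑ l, θ.2.1 l = 1)
    {n d : ℕ → ℕ} (hn : Tendsto n atTop atTop) (hd : Tendsto d atTop atTop) :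
    Tendsto (fun N => law ν b (n N) (d N) θ (regularEvent g m (n N) (d N) c)ᶜ) atTop (𝓝 0) := by
  have hr : 0 < c * (1 / 2 - Real.exp (-1)) := by
    have h1 : Real.exp (-1) < 1 / 2 := by
      have := Real.exp_neg_one_lt_d9
      norm_num at this ⊢
      linarith
    exact mul_pos hc (by linarith)
  have hexp : ∀ {u : ℕ → ℕ}, Tendsto u atTop atTop →
      Tendsto (fun N => Real.exp (-(c * (1 / 2 - Real.exp (-1)) * u N))) atTop (𝓝 0) := by
    intro u hu
    refine Real.tendsto_exp_atBot.comp (tendsto_neg_atTop_atBot.comp ?_)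
    exact (tendsto_natCast_atTop_atTop.comp hu).const_mul_atTop hr
  have h := ENNReal.tendsto_ofReal (((hexp hn).const_mul (g : ℝ)).add
    ((hexp hd).const_mul (m : ℝ)))
  simp only [mul_zero, add_zero, ENNReal.ofReal_zero] at h
  exact tendsto_of_tendsto_of_tendsto_of_le_of_le tendsto_const_nhds h (fun _ => zero_le)
    fun N => law_not_regularEvent_le θ hA hc hθ hπ hρ

/-- The inequivalent assignments contribute a negligible amount to the likelihood. -/
lemma supIsLittleOP_inequivalentSum (hb : Measurable b) (hb0 : ∀ x, 0 ≤ b x) {c : ℝ} (hc : 0 < c)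
    (hc1 : c ≤ 1) {Θ : Set (Param g m)} {K : Set ℝ} (hK : IsCompact K)
    (hKA : K ⊆ interior (natParam ν b)) (hΘ : ∀ θ ∈ Θ, InBox c θ)
    (hπ : ∀ θ ∈ Θ, ∑ k, θ.1 k = 1) (hρ : ∀ θ ∈ Θ, ∑ l, θ.2.1 l = 1)
    (hΘK : ∀ θ ∈ Θ, ∀ k l, θ.2.2 k l ∈ K) {θs : Param g m} (hθs : θs ∈ Θ)
    (h3 : InjOn (obsLaw ν b) (natParam ν b))
    (h4row : ∀ k k', (∀ l, θs.2.2 k l = θs.2.2 k' l) → k = k')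
    (h4col : ∀ l l', (∀ k, θs.2.2 k l = θs.2.2 k l') → l = l')
    {n d : ℕ → ℕ} (hn : Tendsto n atTop atTop) (hd : Tendsto d atTop atTop)
    (hlog : Tendsto (fun N => Real.log (d N) / n N) atTop (𝓝 0))
    (hlog' : Tendsto (fun N => Real.log (n N) / d N) atTop (𝓝 0)) :
    SupIsLittleOP (fun N => law ν b (n N) (d N) θs) Θ
      (fun _ θ ω => inequivalentSum ν b θ ω) (fun _ ω => completeLik ν b θs ω.1 ω.2) := by
  intro ε hε
  have hKn : K ⊆ natParam ν b := hKA.trans interior_subset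
  have hA : ∀ k l, IsProbabilityMeasure (obsLaw ν b (θs.2.2 k l)) :=
    fun k l => isProbabilityMeasure_obsLaw hb hb0 (hKn (hΘK _ hθs k l))
  obtain ⟨L, hL⟩ := exists_lipschitzOnWith_psi hb hb0 hK hKA
  -- first absolute moments
  obtain ⟨A, hA0, habs⟩ : ∃ A : ℝ, 0 ≤ A ∧ ∀ k l,
      ∫⁻ x, ENNReal.ofReal |x| ∂(obsLaw ν b (θs.2.2 k l)) ≤ ENNReal.ofReal A := by
    refine ⟨∑ k, ∑ l, (∫⁻ x, ENNReal.ofReal |x| ∂(obsLaw ν b (θs.2.2 k l))).toReal,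
      Finset.sum_nonneg fun _ _ => Finset.sum_nonneg fun _ _ => ENNReal.toReal_nonneg,
      fun k l => ?_⟩
    rw [← ENNReal.ofReal_toReal
      (lintegral_abs_obsLaw_lt_top hb hb0 (hKA (hΘK _ hθs k l))).ne]
    refine ENNReal.ofReal_le_ofReal ?_
    refine le_trans ?_ (Finset.single_le_sum (f := fun k => ∑ l,
      (∫⁻ x, ENNReal.ofReal |x| ∂(obsLaw ν b (θs.2.2 k l))).toReal)
      (fun _ _ => Finset.sum_nonneg fun _ _ => ENNReal.toReal_nonneg) (Finset.mem_univ k))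
    exact Finset.single_le_sum
      (f := fun l => (∫⁻ x, ENNReal.ofReal |x| ∂(obsLaw ν b (θs.2.2 k l))).toReal)
      (fun _ _ => ENNReal.toReal_nonneg) (Finset.mem_univ l)
  -- separation of the true parameters
  obtain ⟨δ, hδ, hsep⟩ := exists_gap_separation hb hb0 h3 hK hKA
    (fun e : Fin g × Fin m => θs.2.2 e.1 e.2) (fun e => hΘK _ hθs _ _)
  obtain ⟨B, hB, hcost⟩ := exists_relabelling_cost g m (half_pos hc) (by linarith : c / 2 ≤ 1) hδ
  have hcost' : ∀ (n d : ℕ), ∀ θ ∈ Θ, ∀ as : Assign g m n d, IsRegular (c / 2) as → ∀ a,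
      ∃ (σ : Equiv.Perm (Fin g)) (τ : Equiv.Perm (Fin m)),
      B * (d * hamming a.1 (σ ∘ as.1) + n * hamming a.2 (τ ∘ as.2)) ≤ gapSum ν b θs θ as a := by
    intro n d θ hθ as has a
    refine hcost n d as a has (fun k l k' l' => gap ν b (θs.2.2 k l) (θ.2.2 k' l'))
      (fun k l k' l' => gap_nonneg hb hb0 (hKn (hΘK _ hθs _ _)) (hKn (hΘK _ hθ _ _))) ?_ ?_
    · intro k₁ k₂ hk
      -- Distinct rows of the true matrix differ in some column `l`; the separation there holds
      -- whatever entry of `θ` is fitted to it.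
      obtain ⟨l, hl⟩ := not_forall.1 fun h => hk (h4row k₁ k₂ h)
      exact ⟨l, fun k' l' => hsep (k₁, l) (k₂, l) hl _ (hΘK _ hθ _ _)⟩
    · intro l₁ l₂ hk
      obtain ⟨k, hl⟩ := not_forall.1 fun h => hk (h4col l₁ l₂ h)
      exact ⟨k, fun k' l' => hsep (k, l₁) (k, l₂) hl _ (hΘK _ hθ _ _)⟩
  -- coordinates are bounded
  obtain ⟨R₀, hR₀⟩ := hK.isBounded.exists_norm_le
  set R : ℝ := max 1 R₀
  have hR : 1 ≤ R := le_max_left _ _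
  let ι := Fin g ⊕ Fin m ⊕ Fin g × Fin m
  let f : ι → Param g m → ℝ :=
    Sum.elim (fun k θ => θ.1 k) (Sum.elim (fun l θ => θ.2.1 l) fun e θ => θ.2.2 e.1 e.2)
  have hf : ∀ θ ∈ Θ, ∀ i, |f i θ| ≤ R := by
    intro θ hθ i
    rcases i with k | l | e
    · have := (hΘ θ hθ).1 k
      exact (abs_le.2 ⟨by linarith [this.1], this.2⟩ : |θ.1 k| ≤ 1).trans hR
    · have := (hΘ θ hθ).2 l
      exact (abs_le.2 ⟨by linarith [this.1], this.2⟩ : |θ.2.1 l| ≤ 1).trans hR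
    · exact (hR₀ _ (hΘK θ hθ e.1 e.2)).trans (le_max_right _ _)
  set p := Fintype.card ι
  set κ : ℝ := (√(ε * Real.exp (-(2 / c + 1 + L))))⁻¹
  have hκ : 0 ≤ κ := by positivity
  set F : ℝ := ((g.factorial * m.factorial : ℕ) : ℝ)
  have hnR : Tendsto (fun N => (n N : ℝ)) atTop atTop := tendsto_natCast_atTop_atTop.comp hn
  have hdR : Tendsto (fun N => (d N : ℝ)) atTop atTop := tendsto_natCast_atTop_atTop.comp hd
  have hlim1 := tendsto_law_not_regularEvent (ν := ν) (b := b) hA hc (hΘ _ hθs) (hπ _ hθs)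
    (hρ _ hθs) hn hd
  have hlim2 : Tendsto (fun N => ENNReal.ofReal (A / (n N * d N))) atTop (𝓝 0) := by
    rw [← ENNReal.ofReal_zero]
    exact ENNReal.tendsto_ofReal (tendsto_const_nhds.div_atTop (hnR.atTop_mul_atTop₀ hdR))
  -- The power `2 * p` pays for the union bound: there are `p` coordinates, each cut at mesh `(n
  -- d)⁻²`.
  have hlim3 := ENNReal.tendsto_ofReal ((tendsto_pow_mul_exp_sub_one hn hd hlog hlog' hB (2 * p)
    g m (√c)⁻¹).const_mul (κ * (F * (3 * R) ^ p)))
  rw [mul_zero, ENNReal.ofReal_zero] at hlim3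
  have hlim := hlim1.add (hlim2.add hlim3)
  simp only [add_zero] at hlim
  refine tendsto_of_tendsto_of_tendsto_of_le_of_le' tendsto_const_nhds hlim
    (Eventually.of_forall fun _ => zero_le) ?_
  filter_upwards [hn.eventually_gt_atTop 0, hd.eventually_gt_atTop 0] with N hN hD
  have hnd : (1 : ℝ) ≤ n N * d N := by exact_mod_cast Nat.mul_pos hN hD
  obtain ⟨T, hT, hTcard, hTnet⟩ := exists_finite_net Θ f (R := R)
    (η := (((n N : ℝ) * d N) ^ 2)⁻¹) (by positivity) hf
  refine (law_exceedance_le hb hb0 hc hKn hΘ hπ hρ hΘK hθs hL hA0 habs (hcost' (n N) (d N)) hN hD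
    hT (fun θ hθ => ?_) hε).trans (add_le_add le_rfl (add_le_add le_rfl ?_))
  · obtain ⟨θ', hθ', h⟩ := hTnet θ hθ
    exact ⟨θ', hθ', fun k => h (Sum.inl k), fun l => h (Sum.inr (Sum.inl l)),
      fun k l => h (Sum.inr (Sum.inr (k, l)))⟩
  · refine ENNReal.ofReal_le_ofReal ?_
    have hcard : (T.card : ℝ) ≤ (3 * R) ^ p * ((n N : ℝ) * d N) ^ (2 * p) :=
      (Nat.cast_le.2 hTcard).trans (net_card_bound hR hnd p)
    set y : ℝ := Real.exp (g * n N * ((√c)⁻¹ * Real.exp (-(B * d N))) +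
      m * d N * ((√c)⁻¹ * Real.exp (-(B * n N)))) - 1
    have hy : 0 ≤ y := by
      have : (0 : ℝ) ≤ g * n N * ((√c)⁻¹ * Real.exp (-(B * d N))) +
        m * d N * ((√c)⁻¹ * Real.exp (-(B * n N))) := by positivity
      simpa [y] using this
    calc _ ≤ κ * ((3 * R) ^ p * ((n N : ℝ) * d N) ^ (2 * p) * (F * y)) := by
          refine mul_le_mul_of_nonneg_left (mul_le_mul_of_nonneg_right hcard ?_) hκ
          exact mul_nonneg (Nat.cast_nonneg _) hy
      _ = _ := by ring

end Asymptotics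

/-! ### Comparison of the global and local sums with the inequivalent sum -/

section Comparison

variable {ν : Measure ℝ} {b : ℝ → ℝ} {g m n d : ℕ}

lemma dist0_eq_zero {z zs : Fin n → Fin g} (h : LabelEquiv z zs) : dist0 z zs = 0 :=
  Nat.le_zero.1 (Nat.sInf_le ⟨zs, h, by simp [norm0]⟩)

lemma mem_ball_of_assignEquiv {a as : Assign g m n d} (h : AssignEquiv a as) {r : ℝ}
    (hr : 0 ≤ r) : a ∈ ball as r := by
  constructor
  · rw [dist0_eq_zero h.1]; simp only [Nat.cast_zero]; positivity
  · rw [dist0_eq_zero h.2]; simp only [Nat.cast_zero]; positivity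

lemma globalSum_le_inequivalentSum (hb0 : ∀ x, 0 ≤ b x) {c : ℝ} (hc : 0 < c) {θ : Param g m}
    (hθ : InBox c θ) {r : ℝ} (hr : 0 ≤ r) (ω : Outcome g m n d) :
    globalSum ν b r θ ω ≤ inequivalentSum ν b θ ω := by
  refine Finset.sum_le_sum_of_subset_of_nonneg (fun a ha => ?_)
    fun a _ _ => completeLik_nonneg hb0 hc hθ a _
  simp only [inequivalent, Finset.mem_filter, Finset.mem_univ, true_and] at ha ⊢
  exact fun h => ha (mem_ball_of_assignEquiv h hr)

lemma localSum_le_inequivalentSum (hb0 : ∀ x, 0 ≤ b x) {c : ℝ} (hc : 0 < c) {θ : Param g m}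
    (hθ : InBox c θ) (r : ℝ) (ω : Outcome g m n d) :
    localSum ν b r θ ω ≤ inequivalentSum ν b θ ω := by
  refine Finset.sum_le_sum_of_subset_of_nonneg (fun a ha => ?_)
    fun a _ _ => completeLik_nonneg hb0 hc hθ a _
  simp only [inequivalent, Finset.mem_filter, Finset.mem_univ, true_and] at ha ⊢
  exact ha.2

end Comparison

end LBM

theorem mainTheorem11
    -- the exponential family: dominating measure and carrier
    (ν : Measure ℝ) (b : ℝ → ℝ) (hb : Measurable b) (hb0 : ∀ x, 0 ≤ b x)
    -- numbers of groups, parameter space, true parameter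
    (g m : ℕ) (Θ : Set (LBM.Param g m)) (θs : LBM.Param g m)
    (hπ : ∀ θ ∈ Θ, ∑ k, θ.1 k = 1) (hρ : ∀ θ ∈ Θ, ∑ l, θ.2.1 l = 1)
    -- H₁
    (c : ℝ) (hc : 0 < c) (K : Set ℝ) (hK : IsCompact K)
    (hKA : K ⊆ interior (LBM.natParam ν b))
    (h1 : ∀ θ ∈ Θ, (∀ k, θ.1 k ∈ Icc c (1 - c)) ∧ (∀ l, θ.2.1 l ∈ Icc c (1 - c)) ∧
      ∀ k l, θ.2.2 k l ∈ K)
    -- H₂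
    (h2 : θs ∈ intrinsicInterior ℝ Θ)
    -- H₃
    (h3 : InjOn (LBM.obsLaw ν b) (LBM.natParam ν b))
    -- H₄
    (h4row : ∀ k k', (∀ l, θs.2.2 k l = θs.2.2 k' l) → k = k')
    (h4col : ∀ l l', (∀ k, θs.2.2 k l = θs.2.2 k l') → l = l') :
    ∃ C : ℝ, 0 < C ∧
      ∀ n d : ℕ → ℕ, Tendsto n atTop atTop → Tendsto d atTop atTop →
        Tendsto (fun N => Real.log (d N) / n N) atTop (𝓝 0) →
        Tendsto (fun N => Real.log (n N) / d N) atTop (𝓝 0) →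
        -- contribution of global assignments
        (∀ t : ℕ → ℝ, Tendsto t atTop (𝓝[>] 0) →
          (fun N => max (((n N : ℝ) + d N) / (n N * d N))
            (Real.log (n N * d N) / Real.sqrt (n N * d N))) =o[atTop] t →
          LBM.SupIsLittleOP
            (fun N => (LBM.law ν b (n N) (d N) θs)[|LBM.regularEvent g m (n N) (d N) c])
            Θ (fun N θ ω => LBM.globalSum ν b (t N) θ ω)
            (fun _ ω => LBM.completeLik ν b θs ω.1 ω.2) ∧
          LBM.SupIsLittleOP
            (fun N => LBM.law ν b (n N) (d N) θs)
            Θ (fun N θ ω => LBM.globalSum ν b (t N) θ ω)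
            (fun _ ω => LBM.completeLik ν b θs ω.1 ω.2)) ∧
        -- contribution of local assignments
        (LBM.SupIsLittleOP
            (fun N => (LBM.law ν b (n N) (d N) θs)[|LBM.regularEvent g m (n N) (d N) c])
            Θ (fun _ θ ω => LBM.localSum ν b C θ ω)
            (fun _ ω => LBM.completeLik ν b θs ω.1 ω.2) ∧
          LBM.SupIsLittleOP
            (fun N => LBM.law ν b (n N) (d N) θs)
            Θ (fun _ θ ω => LBM.localSum ν b C θ ω)
            (fun _ ω => LBM.completeLik ν b θs ω.1 ω.2)) := by
  have hθs : θs ∈ Θ := intrinsicInterior_subset h2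
  -- An empty vector cannot sum to one. Some row group therefore exists, and its proportion lies in
  -- `[c, 1 - c]`, which bounds `c`.
  have hg : 0 < g := by
    rcases Nat.eq_zero_or_pos g with rfl | h
    · simpa using hπ θs hθs
    · exact h
  have hc1 : c ≤ 1 := by
    have := (h1 θs hθs).1 ⟨0, hg⟩
    linarith [this.1, this.2]
  have hΘ : ∀ θ ∈ Θ, LBM.InBox c θ := fun θ hθ =>
    ⟨fun k => ⟨((h1 θ hθ).1 k).1, ((h1 θ hθ).1 k).2.trans (by linarith)⟩,
      fun l => ⟨((h1 θ hθ).2.1 l).1, ((h1 θ hθ).2.1 l).2.trans (by linarith)⟩⟩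
  have hΘK : ∀ θ ∈ Θ, ∀ k l, θ.2.2 k l ∈ K := fun θ hθ => (h1 θ hθ).2.2
  have hA : ∀ k l, IsProbabilityMeasure (LBM.obsLaw ν b (θs.2.2 k l)) := fun k l =>
    LBM.isProbabilityMeasure_obsLaw hb hb0 (interior_subset (hKA (hΘK _ hθs k l)))
  -- Any positive constant would serve, since the local sum is dominated by the inequivalent sum for
  -- every radius.
  refine ⟨1, one_pos, fun n d hn hd hlog hlog' => ?_⟩
  have hmain := LBM.supIsLittleOP_inequivalentSum hb hb0 hc hc1 hK hKA hΘ hπ hρ hΘK hθs h3 h4row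
    h4col hn hd hlog hlog'
  have hprob : ∀ N, IsProbabilityMeasure (LBM.law ν b (n N) (d N) θs) := fun N =>
    LBM.isProbabilityMeasure_law θs hA hc (hΘ _ hθs) (hπ _ hθs) (hρ _ hθs)
  have hcond := hmain.cond (A := fun N => LBM.regularEvent g m (n N) (d N) c)
    (fun N => LBM.measurableSet_regularEvent c)
    (LBM.tendsto_law_not_regularEvent hA hc (hΘ _ hθs) (hπ _ hθs) (hρ _ hθs) hn hd)
  have hlocal : ∀ᶠ N in atTop, ∀ θ ∈ Θ, ∀ ω : LBM.Outcome g m (n N) (d N),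
      LBM.localSum ν b 1 θ ω ≤ LBM.inequivalentSum ν b θ ω :=
    Eventually.of_forall fun N θ hθ ω =>
      LBM.localSum_le_inequivalentSum hb0 hc (hΘ θ hθ) 1 ω
  refine ⟨fun t ht _ => ?_, hcond.mono hlocal, hmain.mono hlocal⟩
  have hglobal : ∀ᶠ N in atTop, ∀ θ ∈ Θ, ∀ ω : LBM.Outcome g m (n N) (d N),
      LBM.globalSum ν b (t N) θ ω ≤ LBM.inequivalentSum ν b θ ω := by
    filter_upwards [ht.eventually self_mem_nhdsWithin] with N hN θ hθ ω
    exact LBM.globalSum_le_inequivalentSum hb0 hc (hΘ θ hθ) (le_of_lt hN) ω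
  exact ⟨hcond.mono hglobal, hmain.mono hglobal⟩
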